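/- Let $A$ be a Fréchet–Arens–Michael algebra, i.e. a unital associative $\mathbb{C}$-algebra with a complete metrizable locally convex topology that can be defined by submultiplicative seminorms, and let $\alpha : A \to A$ be a topological algebra automorphism ($\alpha$ and $\alpha^{-1}$ continuous; continuity of $\alpha^{-1}$ is automatic). Fix a nonempty directed family of seminorms $\{\|\cdot\|_\lambda : \lambda \in \Lambda\}$ generating the topology of $A$. *Analytic Laurent tensor algebra.* Let $A_\alpha$ be the $A$-bimodule that equals $A$ as a topological vector space and as a left $A$-module, with right action $x \circ a = x\,\alpha(a)$; its inverse is $A_{\alpha^{-1}}$, with $i_1(a \otimes b) = a\,\alpha(b)$ for $a \in A_\alpha$, $b \in A_{\alpha^{-1}}$ and $i_2(b \otimes a) = b\,\alpha^{-1}(a)$. For an Arens–Michael algebra $B$ (a complete Hausdorff locally $m$-convex unital algebra), a triple $(\theta, f, g)$ is called topologically compatible if $\theta : A \to B$ is a continuous unital algebra homomorphism, $f : A_\alpha \to B$ and $g : A_{\alpha^{-1}} \to B$ are continuous $A$-bimodule homomorphisms ($B$ being an $A$-bimodule through $\theta$), and $f(x)g(y) = \theta(i_1(x \otimes y))$, $g(y)f(x)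 = \theta(i_2(y \otimes x))$ for all $x \in A_\alpha$, $y \in A_{\alpha^{-1}}$. The analytic Laurent tensor algebra $\widehat{L}_A(A_\alpha)$ is the Arens–Michael algebra with a topologically compatible triple that is universal: for every topologically compatible triple $(\theta', f', g')$ with values in an Arens–Michael algebra $B$ there is a unique continuous algebra homomorphism $\varphi : \widehat{L}_A(A_\alpha) \to B$ with $\varphi\theta = \theta'$, $\varphi f = f'$, $\varphi g = g'$. *The algebra $A\{x_1, x_2; \alpha\}$.* Let $W_2$ be the set of finite words $w = (w(1), \dots, w(n))$ in the letters $1, 2$, write $|w| = n$, let $c(w)$ be the number of letters $1$ minus the number of letters $2$ in $w$, and let $p(w, i) = c(w(1), \dots, w(i))$. For $w \ne \emptyset$ put $i_w(r_1 \otimes \dots \otimes r_n) = r_1 \prod_{i=2}^{n} \alpha^{p(w, i-1)}(r_i)$ and $$\|r\|_\lambda^{(w)} = \inf \Big\{ \sum_{j=1}^k \|r_{1,j}\|_\lambda \cdots \|r_{n,j}\|_\lambda \;:\; r = \sum_{j=1}^k i_w(r_{1,j} \otimes \dots \otimes r_{n,j}) \Big\},$$ and put $\|r\|_\lambda^{(\emptyset)}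 = \|r\|_\lambda$. Then $$A\{x_1, x_2; \alpha\} = \Big\{ f = \sum_{w \in W_2} a_w x^w : \|f\|_{\lambda, \rho} = \sum_{w \in W_2} \|a_w\|_\lambda^{(w)} \rho^{|w|} < \infty \ \ \forall \lambda \in \Lambda,\ 0 < \rho < \infty \Big\},$$ with the topology generated by the seminorms $\|\cdot\|_{\lambda,\rho}$ and the multiplication determined by $(a x^u)(b x^v) = a\,\alpha^{c(u)}(b)\, x^{uv}$, i.e. $(fg)_w = \sum_{uv = w} f_u\, \alpha^{c(u)}(g_v)$. *Statement.* Let $\overline{(x_1 x_2 - 1,\, x_2 x_1 - 1)}$ be the smallest closed two-sided ideal of $A\{x_1, x_2; \alpha\}$ containing $x_1x_2 - 1$ and $x_2x_1 - 1$. Then there is an isomorphism of topological algebras $$\widehat{L}_A(A_\alpha) \;\cong\; A\{x_1, x_2; \alpha\} \big/ \overline{(x_1 x_2 - 1,\; x_2 x_1 - 1)}$$ that carries $\theta(a)$, $f(a)$, $g(a)$ to the classes of $a$, $a x_1$, $a x_2$ for all $a \in A$. In other words, the quotient on the right is an Arens–Michael algebra, $a \mapsto [a]$, $a \mapsto [a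 x_1]$, $a \mapsto [a x_2]$ is a universal topologically compatible triple with values in it, and hence every other algebra with a universal triple is isomorphic to it, as a topological algebra, compatibly with the triples. -/

import Mathlib

universe u v w

set_option linter.unusedSectionVars false

namespace LaurentTensor

open scoped MulOpposite

/-- An Arens-Michael algebra: a complete (Hausdorff) locally convex unital `ℂ`-algebra whose
topology can be defined by a family of submultiplicative seminorms. -/
structure IsArensMichael (A : Type*) [Ring A] [Algebra ℂ A] [TopologicalSpace A] : Prop where
  t2 : T2Space A
  mconvex : ∃ S : Set (Seminorm ℂ A), (∀ p ∈ S, ∀ a b : A, p (a * b) ≤ p a * p b) ∧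
    WithSeminorms (fun p : S => (p : Seminorm ℂ A))
  complete : ∃ h : IsTopologicalAddGroup A,
    @CompleteSpace A (@IsTopologicalAddGroup.rightUniformSpace A _ _ h)

section Bimodules

variable {A : Type*} [Ring A] [Algebra ℂ A] [TopologicalSpace A]

/-- The bimodule `A_α`: it is `A` as a locally convex space and as a left `A`-module, and the
right action is `x ∘ a = x * α a`. Right modules are modules over `Aᵐᵒᵖ`. -/
def Twisted (_α : A ≃A[ℂ] A) : Type _ := A

variable (α : A ≃A[ℂ] A)

instance : AddCommGroup (Twisted α) := inferInstanceAs (AddCommGroup A)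
instance : TopologicalSpace (Twisted α) := inferInstanceAs (TopologicalSpace A)
instance : Module ℂ (Twisted α) := inferInstanceAs (Module ℂ A)
instance : Module A (Twisted α) := inferInstanceAs (Module A A)

/-- The identity map from `A` to the underlying space of `A_α`. -/
def toTwisted (a : A) : Twisted α := a

/-- The identity map from the underlying space of `A_α` to `A`. -/
def ofTwisted (x : Twisted α) : A := x

instance : Module Aᵐᵒᵖ (Twisted α) where
  smul a x := toTwisted α (ofTwisted α x * α a.unop)
  one_smul x := show ofTwisted α x * α 1 = x by rw [map_one, mul_one]; rfl
  mul_smul a b x := show ofTwisted α x * α (b.unop * a.unop) =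
      ofTwisted α x * α b.unop * α a.unop by rw [map_mul, mul_assoc]
  smul_zero a := show (0 : A) * α a.unop = 0 from zero_mul _
  smul_add a x y := show (ofTwisted α x + ofTwisted α y) * α a.unop = _ from add_mul _ _ _
  add_smul a b x := show ofTwisted α x * α (a.unop + b.unop) =
      ofTwisted α x * α a.unop + ofTwisted α x * α b.unop by rw [map_add, mul_add]
  zero_smul x := show ofTwisted α x * α 0 = 0 by rw [map_zero, mul_zero]

/-- `i₁ : A_α ⊗ A_{α⁻¹} → A`, `i₁ (a ⊗ b) = a α(b)`, on elementary tensors. -/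
def pairing₁ (a : Twisted α) (b : Twisted α.symm) : A := ofTwisted α a * α (ofTwisted α.symm b)

/-- `i₂ : A_{α⁻¹} ⊗ A_α → A`, `i₂ (b ⊗ a) = b α⁻¹(a)`, on elementary tensors. -/
def pairing₂ (b : Twisted α.symm) (a : Twisted α) : A :=
  ofTwisted α.symm b * α.symm (ofTwisted α a)

end Bimodules

/-- A topologically compatible triple `(θ, f, g, B)` for a pair of inverse `A`-bimodules `M`,
`N = M⁻¹` with convolutions `i₁`, `i₂`: a continuous homomorphism `θ : A → B` of unital algebras
and continuous bimodule homomorphisms `f : M → B`, `g : N → B` such that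
`m ∘ (f ⊗ g) = θ ∘ i₁` and `m ∘ (g ⊗ f) = θ ∘ i₂`. The convolutions are given by their values on
elementary tensors, whose span is dense in the completed tensor product over `A`; so it is on
elementary tensors that the two equalities of continuous maps are written. -/
structure CompatibleTriple {A M N : Type*} [Ring A] [Algebra ℂ A] [TopologicalSpace A]
    [AddCommGroup M] [Module ℂ M] [TopologicalSpace M] [Module A M] [Module Aᵐᵒᵖ M]
    [AddCommGroup N] [Module ℂ N] [TopologicalSpace N] [Module A N] [Module Aᵐᵒᵖ N]
    (i₁ : M → N → A) (i₂ : N → M → A)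
    (B : Type*) [Ring B] [Algebra ℂ B] [TopologicalSpace B] where
  θ : A →A[ℂ] B
  f : M →L[ℂ] B
  g : N →L[ℂ] B
  f_left : ∀ (a : A) (m : M), f (a • m) = θ a * f m
  f_right : ∀ (a : A) (m : M), f (MulOpposite.op a • m) = f m * θ a
  g_left : ∀ (a : A) (n : N), g (a • n) = θ a * g n
  g_right : ∀ (a : A) (n : N), g (MulOpposite.op a • n) = g n * θ a
  compat₁ : ∀ (m : M) (n : N), f m * g n = θ (i₁ m n)
  compat₂ : ∀ (n : N) (m : M), g n * f m = θ (i₂ n m)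

/-- The triple `s = (θ, f, g, L)` makes `L` the analytic Laurent tensor algebra of `M`: `L` is an
Arens-Michael algebra and `s` is universal among the topologically compatible triples with values
in Arens-Michael algebras (in the universe `v`). -/
def IsLaurentTensorAlgebra {A M N : Type*} [Ring A] [Algebra ℂ A] [TopologicalSpace A]
    [AddCommGroup M] [Module ℂ M] [TopologicalSpace M] [Module A M] [Module Aᵐᵒᵖ M]
    [AddCommGroup N] [Module ℂ N] [TopologicalSpace N] [Module A N] [Module Aᵐᵒᵖ N]
    {i₁ : M → N → A} {i₂ : N → M → A}
    {L : Type*} [Ring L] [Algebra ℂ L] [TopologicalSpace L]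
    (s : CompatibleTriple i₁ i₂ L) : Prop :=
  IsArensMichael L ∧
    ∀ (B : Type v) [Ring B] [Algebra ℂ B] [TopologicalSpace B], IsArensMichael B →
      ∀ t : CompatibleTriple i₁ i₂ B, ∃! φ : L →A[ℂ] B,
        (∀ a, φ (s.θ a) = t.θ a) ∧ (∀ m, φ (s.f m) = t.f m) ∧ (∀ n, φ (s.g n) = t.g n)

section Words

/-- `W₂`: the words in two letters; the letter `0 : Fin 2` stands for `1` (the variable `x₁`) and
the letter `1 : Fin 2` for `2` (the variable `x₂`). -/
abbrev Word := List (Fin 2)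

/-- `c(w)`: the number of letters `x₁` minus the number of letters `x₂`. -/
def deg (w : Word) : ℤ := (w.count 0 : ℤ) - (w.count 1 : ℤ)

lemma deg_append (u v : Word) : deg (u ++ v) = deg u + deg v := by
  simp only [deg, List.count_append]; push_cast; ring

lemma deg_nil : deg [] = 0 := by simp [deg]

variable {A : Type*} [Ring A] [Algebra ℂ A] [TopologicalSpace A] (α : A ≃A[ℂ] A)

/-- `α ^ c(w)`, an algebra automorphism of `A`. -/
noncomputable def tw (w : Word) : A ≃ₐ[ℂ] A := (α.toAlgEquiv : A ≃ₐ[ℂ] A) ^ deg w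

lemma tw_nil (a : A) : tw α [] a = a := by simp [tw, deg_nil]

lemma tw_append (u v : Word) (a : A) : tw α (u ++ v) a = tw α u (tw α v a) := by
  simp [tw, deg_append, zpow_add]

/-- `i_w (x₁, …, x_n) = x₁ ∏_{i = 2}^{n} α^{p(w, i - 1)} (x_i)`, `n = |w|`, where `p(w, i)` is `c` of
the first `i` letters of `w`. The entries are numbered from `0` and only the first `|w|` entries
of the sequence `x` are used. -/
noncomputable def iw (w : Word) (x : ℕ → A) : A :=
  ((List.range w.length).map fun i => tw α (w.take i) (x i)).prod

/-- `p(x₁) ⋯ p(x_n)` for `n = |w|`. -/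
noncomputable def cost (p : Seminorm ℂ A) (w : Word) (x : ℕ → A) : ℝ :=
  ∏ i ∈ Finset.range w.length, p (x i)

/-- The seminorm `‖r‖^{(w)}` built from a seminorm `p`: the infimum of
`∑ j, p (x_{1,j}) ⋯ p (x_{|w|,j})` over the finite representations
`r = ∑ j, i_w (x_{1,j} ⊗ ⋯ ⊗ x_{|w|,j})`; for the empty word it is `p` by convention. -/
noncomputable def wordNorm (p : Seminorm ℂ A) (w : Word) (r : A) : ℝ :=
  if w = [] then p r else
    sInf {c : ℝ | ∃ (k : ℕ) (x : Fin k → ℕ → A),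
      r = ∑ j, iw α w (x j) ∧ c = ∑ j, cost p w (x j)}


section WordNormLemmas

lemma cost_nonneg (p : Seminorm ℂ A) (w : Word) (x : ℕ → A) : 0 ≤ cost p w x :=
  Finset.prod_nonneg fun _ _ => apply_nonneg p _

lemma iw_cons (s : Fin 2) (w : Word) (x : ℕ → A) :
    iw α (s :: w) x = x 0 * tw α [s] (iw α w fun i => x (i + 1)) := by
  have h : ∀ i, tw α ((s :: w).take (i + 1)) (x (i + 1)) =
      tw α [s] (tw α (w.take i) (x (i + 1))) := by
    intro i
    rw [← tw_append]; rfl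
  simp only [iw, List.length_cons, List.range_succ_eq_map, List.map_cons, List.map_map,
    List.prod_cons, List.take_zero, tw_nil, map_list_prod]
  congr 2
  apply List.map_congr_left
  intro i _
  exact h i

lemma cost_cons (p : Seminorm ℂ A) (s : Fin 2) (w : Word) (x : ℕ → A) :
    cost p (s :: w) x = p (x 0) * cost p w fun i => x (i + 1) := by
  simp only [cost, List.length_cons, Finset.prod_range_succ', mul_comm]

lemma iw_nil (x : ℕ → A) : iw α [] x = 1 := by simp [iw]

lemma cost_nil (p : Seminorm ℂ A) (x : ℕ → A) : cost p [] x = 1 := by simp [cost]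

lemma iw_single (w : Word) (r : A) : w ≠ [] → iw α w (fun i => if i = 0 then r else 1) = r := by
  intro hw
  obtain ⟨s, w, rfl⟩ := List.exists_cons_of_ne_nil hw
  have : iw α w (fun _ => (1 : A)) = 1 := by simp [iw]
  simp [iw_cons, this]

lemma wordNorm_le {ι : Type*} [Fintype ι] (p : Seminorm ℂ A) {w : Word} (hw : w ≠ [])
    (x : ι → ℕ → A) : wordNorm α p w (∑ j, iw α w (x j)) ≤ ∑ j, cost p w (x j) := by
  rw [wordNorm, if_neg hw]
  refine csInf_le ⟨0, ?_⟩ ⟨Fintype.card ι, fun j => x ((Fintype.equivFin ι).symm j), ?_, ?_⟩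
  · rintro c ⟨k, x, -, rfl⟩
    exact Finset.sum_nonneg fun _ _ => cost_nonneg p w _
  · exact ((Fintype.equivFin ι).symm.sum_comp fun j => iw α w (x j)).symm
  · exact ((Fintype.equivFin ι).symm.sum_comp fun j => cost p w (x j)).symm

/-- Whatever is bounded by `K p (x₁) ⋯ p (x_n)` on `i_w (x₁, …, x_n)` is bounded by
`K ‖·‖^{(w)}`. -/
lemma le_wordNorm (p : Seminorm ℂ A) {w : Word} (hw : w ≠ []) (S : A → ℝ) (hS0 : S 0 ≤ 0)
    (hS : ∀ a b, S (a + b) ≤ S a + S b) {K : ℝ} (hK : 0 ≤ K)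
    (h : ∀ x, S (iw α w x) ≤ K * cost p w x) (r : A) : S r ≤ K * wordNorm α p w r := by
  have hsum : ∀ {ι : Type} (s : Finset ι) (y : ι → A), S (∑ j ∈ s, y j) ≤ ∑ j ∈ s, S (y j) := by
    intro ι s y
    exact Finset.le_sum_of_subadditive_on_pred S (fun _ => True) hS0
      (fun a b _ _ => hS a b) (fun _ _ _ _ => trivial) y (fun _ _ => trivial)
  rw [wordNorm, if_neg hw]
  have key : ∀ c ∈ {c : ℝ | ∃ (k : ℕ) (x : Fin k → ℕ → A),
      r = ∑ j, iw α w (x j) ∧ c = ∑ j, cost p w (x j)}, S r ≤ K * c := by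
    rintro c ⟨k, x, rfl, rfl⟩
    refine (hsum _ _).trans ?_
    rw [Finset.mul_sum]
    exact Finset.sum_le_sum fun j _ => h (x j)
  have hne : {c : ℝ | ∃ (k : ℕ) (x : Fin k → ℕ → A),
      r = ∑ j, iw α w (x j) ∧ c = ∑ j, cost p w (x j)}.Nonempty :=
    ⟨_, 1, fun _ i => if i = 0 then r else 1, by simp [iw_single α w r hw], rfl⟩
  rcases hK.eq_or_lt with rfl | hK
  · obtain ⟨c, hc⟩ := hne
    simpa using key c hc
  · rw [← div_le_iff₀' hK]
    exact le_csInf hne fun c hc => by rw [div_le_iff₀' hK]; exact key c hc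

lemma wordNorm_nonneg (p : Seminorm ℂ A) (w : Word) (r : A) : 0 ≤ wordNorm α p w r := by
  rw [wordNorm]
  split_ifs
  · exact apply_nonneg p r
  · refine Real.sInf_nonneg ?_
    rintro c ⟨k, x, -, rfl⟩
    exact Finset.sum_nonneg fun _ _ => cost_nonneg p w _

lemma wordNorm_iw_le (p : Seminorm ℂ A) {w : Word} (hw : w ≠ []) (x : ℕ → A) :
    wordNorm α p w (iw α w x) ≤ cost p w x := by
  simpa using wordNorm_le α p hw (fun _ : Unit => x)

lemma wordNorm_zero (p : Seminorm ℂ A) (w : Word) : wordNorm α p w 0 = 0 := by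
  by_cases hw : w = []
  · simp [wordNorm, hw]
  · refine le_antisymm ?_ (wordNorm_nonneg α p w 0)
    simpa using wordNorm_le α p hw (fun x : Empty => x.elim)

lemma wordNorm_add_le (p : Seminorm ℂ A) (w : Word) (a b : A) :
    wordNorm α p w (a + b) ≤ wordNorm α p w a + wordNorm α p w b := by
  by_cases hw : w = []
  · simpa [wordNorm, hw] using map_add_le_add p a b
  have h2 : ∀ (k : ℕ) (x : Fin k → ℕ → A),
      wordNorm α p w (a + ∑ j, iw α w (x j)) ≤ wordNorm α p w a + ∑ j, cost p w (x j) := by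
    intro k x
    suffices wordNorm α p w (a + ∑ j, iw α w (x j)) - ∑ j, cost p w (x j) ≤
        wordNorm α p w a by linarith
    conv_rhs => rw [wordNorm, if_neg hw]
    refine le_csInf ⟨_, 1, fun _ i => if i = 0 then a else 1, by simp [iw_single α w a hw], rfl⟩ ?_
    rintro c ⟨l, y, rfl, rfl⟩
    have := wordNorm_le α p hw (Sum.elim y x)
    simp only [Fintype.sum_sum_type, Sum.elim_inl, Sum.elim_inr] at this
    linarith
  suffices wordNorm α p w (a + b) - wordNorm α p w a ≤ wordNorm α p w b by linarith
  conv_rhs => rw [wordNorm, if_neg hw]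
  refine le_csInf ⟨_, 1, fun _ i => if i = 0 then b else 1, by simp [iw_single α w b hw], rfl⟩ ?_
  rintro c ⟨l, y, rfl, rfl⟩
  linarith [h2 l y]

lemma wordNorm_smul_le (p : Seminorm ℂ A) (w : Word) (c : ℂ) (a : A) :
    wordNorm α p w (c • a) ≤ ‖c‖ * wordNorm α p w a := by
  by_cases hw : w = []
  · simp [wordNorm, hw, map_smul_eq_mul]
  refine le_wordNorm α p hw (fun a => wordNorm α p w (c • a)) (by simp [wordNorm_zero])
    (fun a b => by rw [smul_add]; exact wordNorm_add_le α p w _ _) (norm_nonneg c) (fun x => ?_) a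
  obtain ⟨s, w, rfl⟩ := List.exists_cons_of_ne_nil hw
  have h := wordNorm_iw_le α p hw (fun i => if i = 0 then c • x 0 else x i)
  simp only [iw_cons, cost_cons, ↓reduceIte, Nat.add_eq_zero_iff, one_ne_zero, and_false,
    smul_mul_assoc, map_smul_eq_mul] at h ⊢
  rwa [mul_assoc] at h

/-- `‖·‖^{(w)}` as a seminorm. -/
noncomputable def wordSeminorm (p : Seminorm ℂ A) (w : Word) : Seminorm ℂ A :=
  Seminorm.ofSMulLE (wordNorm α p w) (wordNorm_zero α p w) (wordNorm_add_le α p w)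
    (wordNorm_smul_le α p w)

/-- The estimates of the seminorm `p` through `C • q` behind the continuity of products. -/
structure Dominates (p q : Seminorm ℂ A) (C : ℝ) : Prop where
  one_le : 1 ≤ C
  le : ∀ a, p a ≤ C * q a
  mul : ∀ a b, p (a * b) ≤ C * (q a * q b)
  mul_tw : ∀ (s : Fin 2) (a b : A), p (a * tw α [s] b) ≤ C * (q a * q b)

variable {α}

lemma Dominates.cost_le {p q : Seminorm ℂ A} {C : ℝ} (h : Dominates α p q C) (w : Word)
    (x : ℕ → A) : cost p w x ≤ C ^ w.length * cost q w x := by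
  unfold cost
  calc _ ≤ ∏ i ∈ Finset.range w.length, C * q (x i) :=
        Finset.prod_le_prod (fun _ _ => apply_nonneg p _) (fun i _ => h.le _)
    _ = _ := by simp [Finset.prod_mul_distrib]

/-- Multiplying the concatenated word. -/
lemma exists_append (u v : Word) (x y : ℕ → A) : ∃ z : ℕ → A,
    iw α (u ++ v) z = iw α u x * tw α u (iw α v y) ∧
      ∀ p : Seminorm ℂ A, cost p (u ++ v) z = cost p u x * cost p v y := by
  induction u generalizing x with
  | nil => exact ⟨y, by simp [iw_nil, tw_nil], fun p => by simp [cost_nil]⟩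
  | cons s u ih =>
    obtain ⟨z, h1, h2⟩ := ih (fun i => x (i + 1))
    refine ⟨fun i => if i = 0 then x 0 else z (i - 1), ?_, fun p => ?_⟩
    · have := tw_append α [s] u (iw α v y)
      simp only [List.cons_append, List.nil_append] at this
      simp [iw_cons, h1, this, mul_assoc]
    · simp [cost_cons, h2, mul_assoc]

lemma Dominates.exists_left {p q : Seminorm ℂ A} {C : ℝ} (h : Dominates α p q C) (a : A)
    {w : Word} (hw : w ≠ []) (x : ℕ → A) : ∃ z : ℕ → A, iw α w z = a * iw α w x ∧
      cost p w z ≤ C ^ w.length * (q a * cost q w x) := by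
  obtain ⟨s, w, rfl⟩ := List.exists_cons_of_ne_nil hw
  refine ⟨fun i => if i = 0 then a * x 0 else x i, by simp [iw_cons, mul_assoc], ?_⟩
  simp only [cost_cons, ↓reduceIte, Nat.add_eq_zero_iff, one_ne_zero, and_false, List.length_cons]
  calc _ ≤ (C * (q a * q (x 0))) * (C ^ w.length * cost q w fun i => x (i + 1)) :=
        mul_le_mul (h.mul _ _) (h.cost_le _ _) (cost_nonneg _ _ _)
          (mul_nonneg (by linarith [h.one_le])
            (mul_nonneg (apply_nonneg q _) (apply_nonneg q _)))
    _ = _ := by ring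

lemma Dominates.exists_right {p q : Seminorm ℂ A} {C : ℝ} (h : Dominates α p q C) (b : A)
    {w : Word} (hw : w ≠ []) (x : ℕ → A) : ∃ z : ℕ → A, iw α w z = iw α w x * tw α w b ∧
      cost p w z ≤ C ^ w.length * (cost q w x * q b) := by
  induction w generalizing x with
  | nil => exact absurd rfl hw
  | cons s w ih =>
    by_cases hw' : w = []
    · subst hw'
      refine ⟨fun _ => x 0 * tw α [s] b, by simp [iw_cons, iw_nil], ?_⟩
      simpa [cost_cons, cost_nil] using h.mul_tw s (x 0) b
    · obtain ⟨z, h1, h2⟩ := ih hw' (fun i => x (i + 1))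
      refine ⟨fun i => if i = 0 then x 0 else z (i - 1), ?_, ?_⟩
      · have := tw_append α [s] w b
        simp only [List.cons_append, List.nil_append] at this
        simp [iw_cons, h1, this, mul_assoc]
      · simp only [cost_cons, ↓reduceIte, Nat.add_eq_zero_iff, one_ne_zero, and_false,
          Nat.add_sub_cancel, List.length_cons]
        calc _ ≤ (C * q (x 0)) * (C ^ w.length * ((cost q w fun i => x (i + 1)) * q b)) :=
              mul_le_mul (h.le _) h2 (cost_nonneg _ _ _)
                (mul_nonneg (by linarith [h.one_le]) (apply_nonneg q _))
          _ = _ := by ring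

lemma Dominates.wordNorm_mul_le {p q : Seminorm ℂ A} {C : ℝ} (h : Dominates α p q C)
    (u v : Word) (a b : A) : wordNorm α p (u ++ v) (a * tw α u b) ≤
      C * ((C ^ u.length * wordNorm α q u a) * (C ^ v.length * wordNorm α q v b)) := by
  have hC : 0 ≤ C := zero_le_one.trans h.one_le
  by_cases hu : u = []
  · subst hu
    simp only [List.nil_append, tw_nil, List.length_nil, pow_zero, one_mul]
    have e : wordNorm α q [] a = q a := by simp [wordNorm]
    rw [e]
    by_cases hv : v = []
    · subst hv
      simpa [wordNorm] using h.mul a b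
    have : wordNorm α p v (a * b) ≤ (C ^ v.length * q a) * wordNorm α q v b := by
      refine le_wordNorm α q hv (fun b => wordNorm α p v (a * b)) (by simp [wordNorm_zero])
        (fun b c => by rw [mul_add]; exact wordNorm_add_le α p v _ _)
        (mul_nonneg (pow_nonneg hC _) (apply_nonneg q _)) (fun x => ?_) b
      obtain ⟨z, h1, h2⟩ := h.exists_left a hv x
      rw [← h1, mul_assoc]
      exact (wordNorm_iw_le α p hv z).trans h2
    have h3 : 0 ≤ (C ^ v.length * q a) * wordNorm α q v b :=
      mul_nonneg (mul_nonneg (pow_nonneg hC _) (apply_nonneg q _)) (wordNorm_nonneg _ _ _ _)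
    nlinarith [h.one_le]
  have huv : u ++ v ≠ [] := by simp [hu]
  suffices wordNorm α p (u ++ v) (a * tw α u b) ≤
      (C ^ u.length * (C ^ v.length * wordNorm α q v b)) * wordNorm α q u a by
    have h3 : 0 ≤ (C ^ u.length * (C ^ v.length * wordNorm α q v b)) * wordNorm α q u a :=
      (wordNorm_nonneg _ _ _ _).trans this
    nlinarith [h.one_le]
  refine le_wordNorm α q hu (fun a => wordNorm α p (u ++ v) (a * tw α u b))
    (by simp [wordNorm_zero]) (fun a c => by rw [add_mul]; exact wordNorm_add_le α p _ _ _)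
    (mul_nonneg (pow_nonneg hC _) (mul_nonneg (pow_nonneg hC _) (wordNorm_nonneg _ _ _ _)))
    (fun x => ?_) a
  by_cases hv : v = []
  · subst hv
    obtain ⟨z, h1, h2⟩ := h.exists_right b hu x
    rw [← h1]
    simp only [List.append_nil]
    refine (wordNorm_iw_le α p hu z).trans (h2.trans (le_of_eq ?_))
    simp only [wordNorm, List.length_nil, pow_zero, ↓reduceIte]
    ring
  have : wordNorm α p (u ++ v) (iw α u x * tw α u b) ≤
      (C ^ (u.length + v.length) * cost q u x) * wordNorm α q v b := by
    refine le_wordNorm α q hv (fun b => wordNorm α p (u ++ v) (iw α u x * tw α u b))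
      (by simp [wordNorm_zero])
      (fun b c => by rw [map_add, mul_add]; exact wordNorm_add_le α p _ _ _)
      (mul_nonneg (pow_nonneg hC _) (cost_nonneg _ _ _)) (fun y => ?_) b
    obtain ⟨z, h1, h2⟩ := exists_append (α := α) u v x y
    rw [← h1]
    refine (wordNorm_iw_le α p huv z).trans ((h.cost_le _ _).trans (le_of_eq ?_))
    rw [h2 q, List.length_append]
    ring
  refine this.trans (le_of_eq ?_)
  rw [pow_add]; ring

lemma exists_dominates (hA : IsArensMichael A) {Λ : Type*} [Nonempty Λ] {p : Λ → Seminorm ℂ A}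
    (hp : WithSeminorms p) (hd : Directed (· ≤ ·) p) (l : Λ) :
    ∃ (m : Λ) (C : ℝ), Dominates α (p l) (p m) C := by
  have bound : ∀ q : Seminorm ℂ A, Continuous q → ∃ (m : Λ) (C : ℝ), 1 ≤ C ∧
      ∀ a, q a ≤ C * p m a := by
    intro q hq
    obtain ⟨s, C, -, h⟩ := Seminorm.bound_of_continuous hp q hq
    obtain ⟨m, hm⟩ := hd.finset_le s
    have hs : s.sup p ≤ p m := Finset.sup_le hm
    refine ⟨m, C + 1, by simp, fun a => ?_⟩
    calc q a ≤ C * (s.sup p) a := h a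
      _ ≤ C * p m a := by gcongr; exact hs a
      _ ≤ (C + 1) * p m a := by have := apply_nonneg (p m) a; nlinarith
  obtain ⟨S, hS, hSt⟩ := hA.mconvex
  obtain ⟨s, C₁, -, h₁⟩ := Seminorm.bound_of_continuous hSt (p l) (hp.continuous_seminorm l)
  obtain ⟨t, ht⟩ : ∃ t : Seminorm ℂ A, t = s.sup (fun p : S => (p : Seminorm ℂ A)) := ⟨_, rfl⟩
  have htc : Continuous t := ht ▸ hSt.finset_sups.continuous_seminorm s
  have htm : ∀ a b, t (a * b) ≤ t a * t b := by
    intro a b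
    rw [ht]
    refine Seminorm.finset_sup_apply_le
      (mul_nonneg (apply_nonneg _ _) (apply_nonneg _ _)) fun i hi => ?_
    have hi' : (i : Seminorm ℂ A) ≤ s.sup (fun p : S => (p : Seminorm ℂ A)) :=
      Finset.le_sup (f := fun p : S => (p : Seminorm ℂ A)) hi
    exact (hS i i.2 a b).trans
      (mul_le_mul (hi' a) (hi' b) (apply_nonneg _ _) (apply_nonneg _ _))
  have htw : ∀ s : Fin 2, Continuous fun a => tw α [s] a := by
    intro s
    fin_cases s
    · have : (fun a => tw α [0] a) = α := by funext a; simp [tw, deg]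
      exact this ▸ α.continuous
    · have : (fun a => tw α [1] a) = α.symm := by
        funext a
        simp only [tw, deg, List.count_singleton]
        simp only [Fin.isValue, BEq.rfl, ↓reduceIte, Nat.cast_one, one_ne_zero, beq_iff_eq,
          CharP.cast_eq_zero, zero_sub, Int.reduceNeg, zpow_neg, zpow_one]
        rfl
      exact this ▸ α.symm.continuous
  obtain ⟨T, hT⟩ : ∃ T : Seminorm ℂ A, T = p l + t + t.comp (tw α [0]).toLinearMap +
      t.comp (tw α [1]).toLinearMap := ⟨_, rfl⟩
  have hTa : ∀ a, T a = p l a + t a + t (tw α [0] a) + t (tw α [1] a) := fun a => by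
    rw [hT]; rfl
  have hTc : Continuous T := by
    have : (T : A → ℝ) = fun a => p l a + t a + t (tw α [0] a) + t (tw α [1] a) := funext hTa
    rw [this]
    exact (((hp.continuous_seminorm l).add htc).add (htc.comp (htw 0))).add (htc.comp (htw 1))
  obtain ⟨m, C, hC, h⟩ := bound T hTc
  have hn : ∀ a, 0 ≤ t a := fun a => apply_nonneg t a
  have hl : ∀ a, 0 ≤ p l a := fun a => apply_nonneg (p l) a
  have hm : ∀ a, 0 ≤ p m a := fun a => apply_nonneg (p m) a
  have e1 : ∀ a, p l a ≤ C * p m a := fun a => by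
    linarith [h a, hTa a, hn a, hn (tw α [0] a), hn (tw α [1] a)]
  have e2 : ∀ a, t a ≤ C * p m a := fun a => by
    linarith [h a, hTa a, hl a, hn (tw α [0] a), hn (tw α [1] a)]
  have e3 : ∀ (s : Fin 2) (a : A), t (tw α [s] a) ≤ C * p m a := fun s a => by
    fin_cases s
    · change t (tw α [0] a) ≤ _
      linarith [h a, hTa a, hl a, hn a, hn (tw α [1] a)]
    · change t (tw α [1] a) ≤ _
      linarith [h a, hTa a, hl a, hn a, hn (tw α [0] a)]
  have e4 : ∀ a b c, t b ≤ C * p m c → p l (a * b) ≤ (C₁ + 1) * C ^ 2 * (p m a * p m c) := by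
    intro a b c hb
    have hC1 : (0 : ℝ) ≤ C₁ := C₁.2
    calc p l (a * b) ≤ C₁ * t (a * b) := by rw [ht]; exact h₁ _
      _ ≤ (C₁ + 1) * t (a * b) := by nlinarith [hn (a * b)]
      _ ≤ (C₁ + 1) * ((C * p m a) * (C * p m c)) := by
          refine mul_le_mul_of_nonneg_left ((htm a b).trans ?_) (by linarith)
          exact mul_le_mul (e2 a) hb (hn b) (mul_nonneg (by linarith) (hm a))
      _ = _ := by ring
  have hK : C ≤ (C₁ + 1) * C ^ 2 := by
    have hC1 : (0 : ℝ) ≤ C₁ := C₁.2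
    have : C ≤ C ^ 2 := by nlinarith
    nlinarith
  exact ⟨m, (C₁ + 1) * C ^ 2, hC.trans hK,
    fun a => (e1 a).trans (mul_le_mul_of_nonneg_right hK (hm a)),
    fun a b => e4 a b b (e2 b), fun s a b => e4 a _ b (e3 s b)⟩

end WordNormLemmas

end Words

section Series

/-- Formal series `∑ a_w x^w` over all words `w`, with coefficients in `A` on the left. -/
@[ext]
structure FormalSeries {A : Type*} [Ring A] [Algebra ℂ A] [TopologicalSpace A]
    (α : A ≃A[ℂ] A) where
  coeff : Word → A

variable {A : Type*} [Ring A] [Algebra ℂ A] [TopologicalSpace A] {α : A ≃A[ℂ] A}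

namespace FormalSeries

instance : Zero (FormalSeries α) := ⟨⟨0⟩⟩
instance : Add (FormalSeries α) := ⟨fun f g => ⟨f.coeff + g.coeff⟩⟩
instance : Neg (FormalSeries α) := ⟨fun f => ⟨-f.coeff⟩⟩
instance : Sub (FormalSeries α) := ⟨fun f g => ⟨f.coeff - g.coeff⟩⟩
instance {R : Type*} [SMul R A] : SMul R (FormalSeries α) := ⟨fun c f => ⟨c • f.coeff⟩⟩

lemma coeff_injective : Function.Injective (coeff : FormalSeries α → Word → A) :=
  fun _ _ h => FormalSeries.ext h

instance : AddCommGroup (FormalSeries α) :=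
  coeff_injective.addCommGroup coeff rfl (fun _ _ => rfl) (fun _ => rfl) (fun _ _ => rfl)
    (fun _ _ => rfl) (fun _ _ => rfl)

/-- The coefficient map, additively. -/
def coeffHom : FormalSeries α →+ (Word → A) := ⟨⟨coeff, rfl⟩, fun _ _ => rfl⟩

instance : Module ℂ (FormalSeries α) :=
  coeff_injective.module ℂ coeffHom fun _ _ => rfl

/-- The series `a x^w`. -/
def monomial (w : Word) (a : A) : FormalSeries α := ⟨fun u => if u = w then a else 0⟩

instance : One (FormalSeries α) := ⟨monomial [] 1⟩

/-- The product determined by `(a x^u) (b x^v) = a α^{c(u)}(b) x^{uv}`, that is, by concatenation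
of words and the rules `x₁ a = α(a) x₁`, `x₂ a = α⁻¹(a) x₂`. -/
noncomputable instance : Mul (FormalSeries α) :=
  ⟨fun f g => ⟨fun w => ∑ k ∈ Finset.range (w.length + 1),
    f.coeff (w.take k) * tw α (w.take k) (g.coeff (w.drop k))⟩⟩

@[simp] lemma coeff_zero (w : Word) : (0 : FormalSeries α).coeff w = 0 := rfl
@[simp] lemma coeff_add (f g : FormalSeries α) (w : Word) :
    (f + g).coeff w = f.coeff w + g.coeff w := rfl
@[simp] lemma coeff_smul (c : ℂ) (f : FormalSeries α) (w : Word) :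
    (c • f).coeff w = c • f.coeff w := rfl
lemma coeff_one (w : Word) : (1 : FormalSeries α).coeff w = if w = [] then 1 else 0 := rfl
lemma coeff_monomial (w u : Word) (a : A) :
    (monomial w a : FormalSeries α).coeff u = if u = w then a else 0 := rfl
lemma coeff_mul (f g : FormalSeries α) (w : Word) :
    (f * g).coeff w = ∑ k ∈ Finset.range (w.length + 1),
      f.coeff (w.take k) * tw α (w.take k) (g.coeff (w.drop k)) := rfl

lemma mul_assoc' (f g h : FormalSeries α) : f * g * h = f * (g * h) := by
  ext w
  simp only [coeff_mul, Finset.sum_mul, map_sum, map_mul, Finset.mul_sum, Finset.sum_sigma']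
  refine Finset.sum_bij' (fun x _ => ⟨x.2, x.1 - x.2⟩) (fun x _ => ⟨x.1 + x.2, x.1⟩) ?_ ?_ ?_ ?_ ?_
  · rintro ⟨k, j⟩ hx
    simp only [Finset.mem_sigma, Finset.mem_range, List.length_take, List.length_drop] at hx ⊢
    omega
  · rintro ⟨j, i⟩ hx
    simp only [Finset.mem_sigma, Finset.mem_range, List.length_take, List.length_drop] at hx ⊢
    omega
  · rintro ⟨k, j⟩ hx
    simp only [Finset.mem_sigma, Finset.mem_range, List.length_take] at hx ⊢
    have : j + (k - j) = k := by omega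
    simp [this]
  · rintro ⟨j, i⟩ hx
    simp
  · rintro ⟨k, j⟩ hx
    simp only [Finset.mem_sigma, Finset.mem_range, List.length_take] at hx
    have h1 : j + (k - j) = k := by omega
    have h2 : min j k = j := by omega
    have h3 : w.take k = w.take j ++ (w.drop j).take (k - j) := by
      rw [← List.take_add, h1]
    simp only [List.take_take, List.drop_take, List.drop_drop, h1, h2]
    rw [← tw_append, ← h3, mul_assoc]

noncomputable instance : Ring (FormalSeries α) where
  __ := (inferInstance : AddCommGroup (FormalSeries α))
  left_distrib f g h := by ext w; simp [coeff_mul, mul_add, Finset.sum_add_distrib]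
  right_distrib f g h := by ext w; simp [coeff_mul, add_mul, Finset.sum_add_distrib]
  zero_mul f := by ext w; simp [coeff_mul]
  mul_zero f := by ext w; simp [coeff_mul]
  mul_assoc := mul_assoc'
  one_mul f := by
    ext w
    rw [coeff_mul, Finset.sum_eq_single 0]
    · simp [coeff_one, tw_nil]
    · intro k hk hk0
      have : w.take k ≠ [] := by
        rintro h
        rcases List.take_eq_nil_iff.1 h with h | h
        · exact hk0 h
        · subst h; simp at hk; exact hk0 hk
      simp [coeff_one, this]
    · simp
  mul_one f := by
    ext w
    rw [coeff_mul, Finset.sum_eq_single w.length]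
    · simp [coeff_one]
    · intro k hk hk0
      have : w.drop k ≠ [] := by
        rw [Ne, List.drop_eq_nil_iff]
        simp at hk; omega
      simp [coeff_one, this]
    · simp

noncomputable instance : Algebra ℂ (FormalSeries α) :=
  Algebra.ofModule
    (fun c f g => by ext w; simp [coeff_mul, Finset.smul_sum])
    (fun c f g => by ext w; simp [coeff_mul, Finset.smul_sum])

lemma monomial_mul_monomial (u v : Word) (a b : A) :
    (monomial u a : FormalSeries α) * monomial v b = monomial (u ++ v) (a * tw α u b) := by
  ext w
  rw [coeff_mul, coeff_monomial]
  by_cases hw : w = u ++ v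
  · subst hw
    rw [Finset.sum_eq_single u.length]
    · simp [coeff_monomial]
    · intro k hk hku
      have : (u ++ v).take k ≠ u := by
        intro h
        have := congrArg List.length h
        simp at this hk; omega
      simp [coeff_monomial, this]
    · simp
  · rw [if_neg hw]
    refine Finset.sum_eq_zero fun k _ => ?_
    by_cases h1 : w.take k = u
    · have h2 : w.drop k ≠ v := by
        intro h2; exact hw (by rw [← h1, ← h2, List.take_append_drop])
      simp [coeff_monomial, h2]
    · simp [coeff_monomial, h1]

end FormalSeries

variable {Λ : Type*} {p : Λ → Seminorm ℂ A}

open FormalSeries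

/-- `‖f‖_{λ, ρ} = ∑ ‖a_w‖_λ^{(w)} ρ^{|w|} < ∞` for all `λ` and all `ρ > 0`. -/
def IsEntire (p : Λ → Seminorm ℂ A) (f : FormalSeries α) : Prop :=
  ∀ (l : Λ) (ρ : ℝ), 0 < ρ →
    Summable fun w : Word => wordSeminorm α (p l) w (f.coeff w) * ρ ^ w.length

lemma isEntire_monomial (w : Word) (a : A) : IsEntire p (monomial w a : FormalSeries α) := by
  intro l ρ _
  refine summable_of_ne_finset_zero (s := {w}) fun u hu => ?_
  have : u ≠ w := by simpa using hu
  simp [coeff_monomial, this]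

lemma wordSeminorm_apply (q : Seminorm ℂ A) (w : Word) (a : A) :
    wordSeminorm α q w a = wordNorm α q w a := rfl

lemma IsEntire.add {f g : FormalSeries α} (hf : IsEntire p f) (hg : IsEntire p g) :
    IsEntire p (f + g) := by
  intro l ρ hρ
  refine Summable.of_nonneg_of_le (fun w => by positivity) (fun w => ?_)
    ((hf l ρ hρ).add (hg l ρ hρ))
  rw [← add_mul]
  exact mul_le_mul_of_nonneg_right (map_add_le_add _ _ _) (by positivity)

lemma IsEntire.smul (c : ℂ) {f : FormalSeries α} (hf : IsEntire p f) : IsEntire p (c • f) := by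
  intro l ρ hρ
  simpa [map_smul_eq_mul, mul_assoc] using (hf l ρ hρ).mul_left ‖c‖

lemma IsEntire.mul [Nonempty Λ] (hA : IsArensMichael A) (hp : WithSeminorms p)
    (hd : Directed (· ≤ ·) p) {f g : FormalSeries α} (hf : IsEntire p f) (hg : IsEntire p g) :
    IsEntire p (f * g) := by
  intro l ρ hρ
  obtain ⟨m, C, h⟩ := exists_dominates (α := α) hA hp hd l
  have hC : 0 < C := zero_lt_one.trans_le h.one_le
  have hF := hf m (C * ρ) (by positivity)
  have hG := hg m (C * ρ) (by positivity)
  have hFG := (hF.mul_of_nonneg hG (fun w => by positivity) (fun w => by positivity)).mul_left C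
  let e : (Σ w : Word, Fin (w.length + 1)) → Word × Word :=
    fun x => (x.1.take x.2, x.1.drop x.2)
  have he : Function.Injective e := by
    rintro ⟨w, k, hk⟩ ⟨w', k', hk'⟩ hee
    simp only [e, Prod.mk.injEq] at hee
    obtain ⟨h1, h2⟩ := hee
    have hw : w = w' := by rw [← List.take_append_drop k w, h1, h2, List.take_append_drop]
    subst hw
    have := congrArg List.length h1
    simp only [List.length_take] at this
    have hkk : k = k' := by omega
    subst hkk
    rfl
  have hs := (hFG.comp_injective he).sigma
  refine Summable.of_nonneg_of_le (fun w => by positivity) (fun w => ?_) hs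
  rw [tsum_fintype, coeff_mul, Finset.sum_range]
  refine (mul_le_mul_of_nonneg_right (Finset.le_sum_of_subadditive _
    (map_zero (wordSeminorm α (p l) w)).le (map_add_le_add _) _ _) (by positivity)).trans ?_
  rw [Finset.sum_mul]
  refine Finset.sum_le_sum fun k _ => ?_
  have hb := h.wordNorm_mul_le (w.take k) (w.drop k) (f.coeff (w.take k)) (g.coeff (w.drop k))
  rw [List.take_append_drop] at hb
  have hlen : ρ ^ w.length = ρ ^ (w.take k).length * ρ ^ (w.drop k).length := by
    rw [← pow_add, ← List.length_append, List.take_append_drop]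
  simp only [wordSeminorm_apply, Function.comp_apply, e]
  refine (mul_le_mul_of_nonneg_right hb (by positivity)).trans (le_of_eq ?_)
  rw [hlen, mul_pow, mul_pow]
  ring

/-- The algebra `A{x₁, x₂; α}` of the series `f = ∑ a_w x^w` with all `‖f‖_{λ, ρ}` finite. -/
noncomputable def entireSubalgebra [Nonempty Λ] (hA : IsArensMichael A) (hp : WithSeminorms p)
    (hd : Directed (· ≤ ·) p) (α : A ≃A[ℂ] A) : Subalgebra ℂ (FormalSeries α) where
  carrier := {f | IsEntire p f}
  add_mem' := IsEntire.add
  mul_mem' := IsEntire.mul hA hp hd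
  algebraMap_mem' c := by
    rw [Algebra.algebraMap_eq_smul_one]
    exact IsEntire.smul c (isEntire_monomial [] 1)

/-- `A{x₁, x₂; α}` as a type. -/
abbrev EntireSeries [Nonempty Λ] (hA : IsArensMichael A) (hp : WithSeminorms p)
    (hd : Directed (· ≤ ·) p) (α : A ≃A[ℂ] A) : Type _ := ↥(entireSubalgebra hA hp hd α)

variable [Nonempty Λ] (hA : IsArensMichael A) (hp : WithSeminorms p)
  (hd : Directed (· ≤ ·) p) (α : A ≃A[ℂ] A)

/-- The seminorms `‖f‖_{λ, ρ} = ∑ ‖a_w‖_λ^{(w)} ρ^{|w|}` on `A{x₁, x₂; α}`. -/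
noncomputable def entireSeminorm : SeminormFamily ℂ (EntireSeries hA hp hd α)
    (Λ × {ρ : ℝ // 0 < ρ}) := fun i =>
  Seminorm.ofSMulLE
    (fun f => ∑' w : Word, wordSeminorm α (p i.1) w (f.1.coeff w) * (i.2 : ℝ) ^ w.length)
    (by simp)
    (fun f g => by
      rw [← (f.2 i.1 i.2 i.2.2).tsum_add (g.2 i.1 i.2 i.2.2)]
      refine (IsEntire.add f.2 g.2 i.1 i.2 i.2.2).tsum_le_tsum (fun w => ?_)
        ((f.2 i.1 i.2 i.2.2).add (g.2 i.1 i.2 i.2.2))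
      rw [← add_mul]
      exact mul_le_mul_of_nonneg_right (map_add_le_add _ _ _) (pow_nonneg i.2.2.le _))
    (fun c f => by
      rw [← tsum_mul_left]
      refine le_of_eq (tsum_congr fun w => ?_)
      rw [← mul_assoc]
      exact congrArg (· * _) (map_smul_eq_mul (wordSeminorm α (p i.1) w) c (f.1.coeff w)))

/-- The topology of `A{x₁, x₂; α}` is generated by the seminorms `‖·‖_{λ, ρ}`. -/
noncomputable instance : TopologicalSpace (EntireSeries hA hp hd α) :=
  (entireSeminorm hA hp hd α).moduleFilterBasis.topology

/-- The element `a x^w` of `A{x₁, x₂; α}`. -/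
noncomputable def mono (w : Word) (a : A) : EntireSeries hA hp hd α :=
  ⟨monomial w a, isEntire_monomial w a⟩

/-- `x₁`. -/
noncomputable def x₁ : EntireSeries hA hp hd α := mono hA hp hd α [0] 1

/-- `x₂`. -/
noncomputable def x₂ : EntireSeries hA hp hd α := mono hA hp hd α [1] 1

/-- The closed two-sided ideal generated by `x₁ x₂ - 1` and `x₂ x₁ - 1`: the smallest closed
two-sided ideal that contains both. -/
noncomputable def laurentIdeal : Ideal (EntireSeries hA hp hd α) :=
  sInf {I | I.IsTwoSided ∧ IsClosed (I : Set (EntireSeries hA hp hd α)) ∧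
    x₁ hA hp hd α * x₂ hA hp hd α - 1 ∈ I ∧ x₂ hA hp hd α * x₁ hA hp hd α - 1 ∈ I}

instance : (laurentIdeal hA hp hd α).IsTwoSided where
  mul_mem_of_left b h := by
    rw [laurentIdeal, Submodule.mem_sInf] at h ⊢
    intro I hI
    have := hI.1
    exact Ideal.mul_mem_right (I := I) b (h I hI)

/-- The quotient algebra `A{x₁, x₂; α} / closure (x₁ x₂ - 1, x₂ x₁ - 1)`, with the quotient
topology. -/
abbrev LaurentQuotient : Type _ := EntireSeries hA hp hd α ⧸ laurentIdeal hA hp hd α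

/-- The class of the series `a x^w` in the quotient. -/
noncomputable def classOf (w : Word) (a : A) : LaurentQuotient hA hp hd α :=
  Ideal.Quotient.mk (laurentIdeal hA hp hd α) (mono hA hp hd α w a)

end Series

end LaurentTensor

/-! A compatible triple `(θ, f, g)` in `B` amounts to `θ` together with two mutually inverse
elements `y₁ = f(1)`, `y₂ = g(1)` such that `y₁ θ(a) = θ(α(a)) y₁` and `y₂ θ(a) = θ(α⁻¹(a)) y₂`;
left linearity recovers `f(a) = θ(a) y₁` and `g(a) = θ(a) y₂`. The universal map has to be the
evaluation `∑ a_w x^w ↦ ∑ θ(a_w) y^w`.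

The seminorms `‖·‖^{(w)}` are made for its convergence. The commutation rules turn `θ(i_w(r₁ ⊗ ⋯ ⊗
r_n)) y^w` into `θ(r₁) y_{w(1)} ⋯ θ(r_n) y_{w(n)}`, so a submultiplicative seminorm `t` satisfies
`t(θ(r) y^w) ≤ t(1) (CD)^{|w|} ‖r‖^{(w)}` for nonempty `w`, and the power is absorbed by `ρ`
(`IsMSeminorm.evalSeminorm_iw_le`, `evalHom`). The kernel is a closed two-sided ideal containing
both relations, so evaluation descends to the quotient. It is unique there because every series is
the sum of its monomials (`hasSum_mono`).

It remains to see that the quotient is an Arens-Michael algebra. The series algebra is complete for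
the same reason as a weighted `ℓ¹` space. The delicate point is a family of submultiplicative
seminorms: even if `t` is submultiplicative, `(a x^u) b = a α^{c(u)}(b) x^u` places `α(b)` or
`α⁻¹(b)` in the last tensor entry, which `t(b)` does not control. The remedy is to measure the
constant coefficient alone by `t + t ∘ α + t ∘ α⁻¹` (`coeffSeminorm`,
`IsMSeminorm.coeffSeminorm_mul_le`). Since `A` is metrizable, the series algebra is first countable,
so completeness passes to the quotient (`IsArensMichael.quotient`). -/

namespace LaurentTensor

open Filter Topology
open scoped NNReal

/-! ### Submultiplicative seminorms and absolute convergence in Arens-Michael algebras. -/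

section ArensMichael

/-- A continuous submultiplicative seminorm. -/
structure IsMSeminorm {A : Type*} [Ring A] [Algebra ℂ A] [TopologicalSpace A]
    (q : Seminorm ℂ A) : Prop where
  continuous : Continuous q
  mul_le : ∀ a b, q (a * b) ≤ q a * q b

variable {A : Type*} [Ring A] [Algebra ℂ A] [TopologicalSpace A]

lemma seminorm_sum_le {ι : Type*} (q : Seminorm ℂ A) (s : Finset ι) (b : ι → A) :
    q (∑ i ∈ s, b i) ≤ ∑ i ∈ s, q (b i) :=
  Finset.le_sum_of_subadditive q (map_zero q).le (map_add_le_add q) s b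

lemma IsMSeminorm.zero : IsMSeminorm (0 : Seminorm ℂ A) :=
  ⟨continuous_const, fun _ _ => by simp⟩

lemma IsMSeminorm.add {q r : Seminorm ℂ A} (hq : IsMSeminorm q) (hr : IsMSeminorm r) :
    IsMSeminorm (q + r) where
  continuous := hq.continuous.add hr.continuous
  mul_le a b := by
    have h1 := hq.mul_le a b
    have h2 := hr.mul_le a b
    have h3 := mul_nonneg (apply_nonneg q a) (apply_nonneg r b)
    have h4 := mul_nonneg (apply_nonneg r a) (apply_nonneg q b)
    simp only [_root_.add_apply]
    nlinarith

lemma IsMSeminorm.comp {B : Type*} [Ring B] [Algebra ℂ B] [TopologicalSpace B]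
    {q : Seminorm ℂ B} (hq : IsMSeminorm q) {φ : A →ₐ[ℂ] B} (hφ : Continuous φ) :
    IsMSeminorm (q.comp φ.toLinearMap) where
  continuous := hq.continuous.comp hφ
  mul_le a b := by simpa using hq.mul_le (φ a) (φ b)

/-- With all continuous submultiplicative seminorms taken as the new family, one half of the
comparison is automatic: a continuous seminorm is bounded by the old family. Only the domination of
each generator has to be supplied. -/
lemma mconvex_of_le {ι : Type*} {p : SeminormFamily ℂ A ι} (hp : WithSeminorms p)
    (h : ∀ i, ∃ t : Seminorm ℂ A, IsMSeminorm t ∧ ∃ C : ℝ, ∀ a, p i a ≤ C * t a) :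
    ∃ S : Set (Seminorm ℂ A), (∀ p ∈ S, ∀ a b : A, p (a * b) ≤ p a * p b) ∧
      WithSeminorms (fun p : S => (p : Seminorm ℂ A)) := by
  refine ⟨{t | IsMSeminorm t}, fun t ht => ht.mul_le, hp.congr ?_ ?_⟩
  · rintro ⟨t, ht⟩
    obtain ⟨s, C, -, hs⟩ := Seminorm.bound_of_continuous hp t ht.continuous
    exact ⟨s, C, hs⟩
  · refine Seminorm.IsBounded.of_real fun i => ?_
    obtain ⟨t, ht, C, hC⟩ := h i
    exact ⟨{⟨t, ht⟩}, C, fun a => by simpa using hC a⟩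

namespace IsArensMichael

variable (hA : IsArensMichael A)

include hA

lemma topologicalAddGroup : IsTopologicalAddGroup A := hA.complete.1

lemma withSeminorms :
    WithSeminorms (fun t : {t : Seminorm ℂ A // IsMSeminorm t} => (t : Seminorm ℂ A)) := by
  obtain ⟨S, hS, hp⟩ := hA.mconvex
  refine hp.congr ?_ ?_
  · rintro ⟨t, ht⟩
    obtain ⟨s, C, -, hs⟩ := Seminorm.bound_of_continuous hp t ht.continuous
    exact ⟨s, C, hs⟩
  · refine fun i => ⟨{⟨i, hp.continuous_seminorm i, hS i i.2⟩}, 1, fun a => by simp⟩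

/-- Continuous seminorms are bounded by submultiplicative ones. -/
lemma exists_isMSeminorm {q : Seminorm ℂ A} (hq : Continuous q) :
    ∃ t : Seminorm ℂ A, IsMSeminorm t ∧ ∃ C : ℝ, 1 ≤ C ∧ ∀ a, q a ≤ C * t a := by
  obtain ⟨s, C, -, h⟩ := Seminorm.bound_of_continuous hA.withSeminorms q hq
  have key : ∃ t : Seminorm ℂ A, IsMSeminorm t ∧
      ∀ a, s.sup (fun t : {t : Seminorm ℂ A // IsMSeminorm t} => (t : Seminorm ℂ A)) a ≤ t a := by
    clear h
    induction s using Finset.cons_induction with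
    | empty => exact ⟨0, .zero, fun a => by simp⟩
    | cons i s hi ih =>
      obtain ⟨t, ht, hs⟩ := ih
      -- A sum dominates the maximum and is again submultiplicative.
      refine ⟨i + t, i.2.add ht, fun a => ?_⟩
      rw [Finset.sup_cons, Seminorm.sup_apply, _root_.add_apply]
      have := apply_nonneg t a
      have := apply_nonneg (i : Seminorm ℂ A) a
      exact max_le (by linarith) (by linarith [hs a])
  obtain ⟨t, ht, hs⟩ := key
  refine ⟨t, ht, C + 1, by simp, fun a => ?_⟩
  have h1 : (0 : ℝ) ≤ C := C.2
  have h2 := apply_nonneg t a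
  calc q a ≤ C * _ := h a
    _ ≤ C * t a := mul_le_mul_of_nonneg_left (hs a) h1
    _ ≤ (C + 1) * t a := by linarith

lemma exists_ball_subset {U : Set A} (hU : U ∈ 𝓝 (0 : A)) :
    ∃ t : Seminorm ℂ A, IsMSeminorm t ∧ ∃ r > 0, ∀ a, t a < r → a ∈ U := by
  obtain ⟨s, r, hr, hs⟩ := (hA.withSeminorms.mem_nhds_iff 0 U).1 hU
  have hc := hA.withSeminorms.finset_sups.continuous_seminorm s
  obtain ⟨t, ht, C, hC, h⟩ := hA.exists_isMSeminorm hc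
  refine ⟨t, ht, r / C, by positivity, fun a ha => hs ?_⟩
  rw [Seminorm.mem_ball_zero]
  rw [lt_div_iff₀' (by positivity)] at ha
  exact (h a).trans_lt ha

lemma tendsto_nhds {ι : Type*} {f : ι → A} {l : Filter ι} {b : A} :
    Tendsto f l (𝓝 b) ↔
      ∀ t : Seminorm ℂ A, IsMSeminorm t → ∀ ε > 0, ∀ᶠ x in l, t (f x - b) < ε := by
  rw [hA.withSeminorms.tendsto_nhds]
  simp

lemma topologicalRing : IsTopologicalRing A := by
  have := hA.topologicalAddGroup
  have hc : ∀ {t : Seminorm ℂ A}, IsMSeminorm t → Tendsto t (𝓝 0) (𝓝 0) := fun ht => by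
    simpa using ht.continuous.tendsto 0
  refine IsTopologicalRing.of_addGroup_of_nhds_zero ?_ ?_ ?_
  · refine hA.tendsto_nhds.2 fun t ht ε hε => ?_
    have h1 := hc ht
    have := (h1.comp (tendsto_fst (f := 𝓝 (0 : A)) (g := 𝓝 (0 : A)))).mul
      (h1.comp (tendsto_snd (f := 𝓝 (0 : A)) (g := 𝓝 (0 : A))))
    rw [mul_zero] at this
    filter_upwards [this.eventually (gt_mem_nhds hε)] with x hx
    rw [sub_zero]
    exact (ht.mul_le _ _).trans_lt hx
  · refine fun a => hA.tendsto_nhds.2 fun t ht ε hε => ?_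
    have := (hc ht).const_mul (t a)
    rw [mul_zero] at this
    filter_upwards [this.eventually (gt_mem_nhds hε)] with x hx
    simpa using (ht.mul_le _ _).trans_lt hx
  · refine fun a => hA.tendsto_nhds.2 fun t ht ε hε => ?_
    have := (hc ht).mul_const (t a)
    rw [zero_mul] at this
    filter_upwards [this.eventually (gt_mem_nhds hε)] with x hx
    simpa using (ht.mul_le _ _).trans_lt hx

lemma continuousSMul : ContinuousSMul ℂ A := hA.withSeminorms.continuousSMul

/-- Absolutely convergent series converge. -/
lemma summable {ι : Type*} {b : ι → A}
    (h : ∀ t : Seminorm ℂ A, IsMSeminorm t → Summable fun i => t (b i)) : Summable b := by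
  obtain ⟨h1, h2⟩ := hA.complete
  let : UniformSpace A := IsTopologicalAddGroup.rightUniformSpace A
  have : IsUniformAddGroup A := isUniformAddGroup_of_addCommGroup
  have : CompleteSpace A := h2
  rw [summable_iff_vanishing]
  intro U hU
  obtain ⟨t, ht, r, hr, hs⟩ := hA.exists_ball_subset hU
  obtain ⟨s, hs'⟩ := summable_iff_vanishing.1 (h t ht) (Set.Iio r) (gt_mem_nhds hr)
  refine ⟨s, fun s' hd => hs _ ((seminorm_sum_le t _ _).trans_lt (hs' s' hd))⟩

end IsArensMichael

lemma seminorm_tsum_le {ι : Type*} {b : ι → A} {t : Seminorm ℂ A} (ht : Continuous t)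
    (hb : Summable b) (h : Summable fun i => t (b i)) : t (∑' i, b i) ≤ ∑' i, t (b i) :=
  le_of_tendsto_of_tendsto' ((ht.tendsto _).comp hb.hasSum) h.hasSum
    fun s => seminorm_sum_le t s b

end ArensMichael

/-! ### Quotients by closed two-sided ideals. -/

section Quotient

variable {E : Type*} [Ring E] [Algebra ℂ E] (I : Ideal E) [I.IsTwoSided]

/-- The quotient seminorm. -/
noncomputable def quotientSeminorm (N : Seminorm ℂ E) : Seminorm ℂ (E ⧸ I) :=
  Seminorm.ofSMulLE (fun x => ⨅ f : {f : E // Ideal.Quotient.mk I f = x}, N f)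
    (le_antisymm
      ((ciInf_le ⟨0, by rintro _ ⟨f, rfl⟩; exact apply_nonneg N _⟩ ⟨0, map_zero _⟩).trans
        (map_zero N).le)
      (Real.iInf_nonneg fun _ => apply_nonneg N _))
    (fun x y => by
      have hne : ∀ x : E ⧸ I, Nonempty {f : E // Ideal.Quotient.mk I f = x} := fun x =>
        (Ideal.Quotient.mk_surjective x).elim fun f hf => ⟨⟨f, hf⟩⟩
      have := hne x
      have := hne y
      refine le_ciInf_add_ciInf fun f g => ?_
      exact (ciInf_le ⟨0, by rintro _ ⟨f, rfl⟩; exact apply_nonneg N _⟩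
        ⟨f.1 + g.1, by rw [map_add, f.2, g.2]⟩).trans (map_add_le_add N _ _))
    (fun c x => by
      have : Nonempty {f : E // Ideal.Quotient.mk I f = x} :=
        (Ideal.Quotient.mk_surjective x).elim fun f hf => ⟨⟨f, hf⟩⟩
      rw [Real.mul_iInf_of_nonneg (norm_nonneg c)]
      refine le_ciInf fun f => ?_
      refine (ciInf_le ⟨0, by rintro _ ⟨f, rfl⟩; exact apply_nonneg N _⟩
        ⟨c • f.1, ?_⟩).trans (map_smul_eq_mul N c f.1).le
      exact congrArg (c • ·) f.2)

variable {I} {N : Seminorm ℂ E}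

lemma quotientSeminorm_mk_le (f : E) :
    quotientSeminorm I N (Ideal.Quotient.mk I f) ≤ N f :=
  ciInf_le (f := fun g : {g : E // Ideal.Quotient.mk I g = Ideal.Quotient.mk I f} => N g)
    ⟨0, by rintro _ ⟨f, rfl⟩; exact apply_nonneg N _⟩ ⟨f, rfl⟩

lemma exists_lt_of_quotientSeminorm_lt {x : E ⧸ I} {r : ℝ} (h : quotientSeminorm I N x < r) :
    ∃ f, Ideal.Quotient.mk I f = x ∧ N f < r := by
  have : Nonempty {f : E // Ideal.Quotient.mk I f = x} :=
    (Ideal.Quotient.mk_surjective x).elim fun f hf => ⟨⟨f, hf⟩⟩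
  obtain ⟨f, hf⟩ := exists_lt_of_ciInf_lt
    (f := fun f : {f : E // Ideal.Quotient.mk I f = x} => N f) h
  exact ⟨f, f.2, hf⟩

variable [TopologicalSpace E]

lemma isOpenMap_quotientMk [IsTopologicalAddGroup E] :
    IsOpenMap (Ideal.Quotient.mk I : E → E ⧸ I) :=
  QuotientAddGroup.isOpenMap_coe (N := I.toAddSubgroup)

lemma continuous_quotientMk : Continuous (Ideal.Quotient.mk I : E → E ⧸ I) :=
  continuous_coinduced_rng

lemma topologicalAddGroup_quotient [IsTopologicalAddGroup E] : IsTopologicalAddGroup (E ⧸ I) :=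
  inferInstance

lemma IsMSeminorm.quotient [IsTopologicalAddGroup E] (hN : IsMSeminorm N) :
    IsMSeminorm (quotientSeminorm I N) where
  continuous := by
    refine Seminorm.continuous_of_forall fun r hr => ?_
    have h1 : N.ball 0 r ∈ 𝓝 (0 : E) := by
      rw [Seminorm.ball_zero_eq]
      exact hN.continuous.continuousAt.preimage_mem_nhds
        (Iio_mem_nhds (by simpa using hr))
    -- Openness of the quotient map makes the image of an `N`-ball a neighbourhood of zero.
    have h2 := isOpenMap_quotientMk (I := I).image_mem_nhds h1
    rw [map_zero] at h2
    refine mem_of_superset h2 ?_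
    rintro _ ⟨f, hf, rfl⟩
    rw [Seminorm.mem_ball_zero] at hf ⊢
    exact (quotientSeminorm_mk_le f).trans_lt hf
  mul_le x y := by
    refine le_of_forall_pos_lt_add fun ε hε => ?_
    have hx := apply_nonneg (quotientSeminorm I N) x
    have hy := apply_nonneg (quotientSeminorm I N) y
    -- The infima need not be attained, so representatives are taken within `d` of them; by
    -- continuity at `d = 0` the product of the two bounds exceeds the target by less than `ε`.
    have hlim : Tendsto (fun d : ℝ => (quotientSeminorm I N x + d) * (quotientSeminorm I N y + d))
        (𝓝[>] 0) (𝓝 ((quotientSeminorm I N x + 0) * (quotientSeminorm I N y + 0))) :=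
      (((tendsto_const_nhds.add tendsto_id).mul (tendsto_const_nhds.add tendsto_id)).mono_left
        nhdsWithin_le_nhds)
    simp only [add_zero] at hlim
    obtain ⟨d, hd, hd0⟩ := ((hlim.eventually (gt_mem_nhds (lt_add_of_pos_right _ hε))).and
      self_mem_nhdsWithin).exists
    have hd0 : 0 < d := hd0
    obtain ⟨f, hfx, hf⟩ := exists_lt_of_quotientSeminorm_lt
      (lt_add_of_pos_right (quotientSeminorm I N x) hd0)
    obtain ⟨g, hgy, hg⟩ := exists_lt_of_quotientSeminorm_lt
      (lt_add_of_pos_right (quotientSeminorm I N y) hd0)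
    calc quotientSeminorm I N (x * y) ≤ N (f * g) := by
          rw [← hfx, ← hgy, ← map_mul]; exact quotientSeminorm_mk_le _
      _ ≤ N f * N g := hN.mul_le f g
      _ ≤ _ := mul_le_mul hf.le hg.le (apply_nonneg N _) (by linarith)
      _ < _ := hd

/-- Quotients of first countable Arens-Michael algebras by closed two-sided ideals are
Arens-Michael algebras. -/
theorem IsArensMichael.quotient (hE : IsArensMichael E) [FirstCountableTopology E]
    (hI : IsClosed (I : Set E)) : IsArensMichael (E ⧸ I) where
  t2 := by
    have := hE.topologicalAddGroup
    have : T3Space (E ⧸ I) := QuotientAddGroup.instT3Space (N := I.toAddSubgroup) (hN := hI)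
    infer_instance
  mconvex := by
    have := hE.topologicalAddGroup
    have := topologicalAddGroup_quotient (I := I)
    -- Balls of single submultiplicative seminorms already form a base at zero in `E`, and a ball of
    -- a quotient seminorm is the image of a ball, so the quotient seminorms generate the quotient
    -- topology.
    have h : WithSeminorms fun t : {t : Seminorm ℂ E // IsMSeminorm t} =>
        quotientSeminorm I (t : Seminorm ℂ E) := by
      rw [SeminormFamily.withSeminorms_iff_nhds_eq_iInf]
      refine le_antisymm (le_iInf fun t => ?_) fun U hU => ?_
      · have := t.2.quotient (I := I).continuous.tendsto 0
        rw [map_zero] at this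
        exact this.le_comap
      · have h1 : Ideal.Quotient.mk I ⁻¹' U ∈ 𝓝 (0 : E) :=
          continuous_quotientMk.continuousAt.preimage_mem_nhds (by rwa [map_zero])
        obtain ⟨t, ht, r, hr, hs⟩ := hE.exists_ball_subset h1
        refine mem_iInf_of_mem ⟨t, ht⟩ ⟨Set.Iio r, gt_mem_nhds hr, fun x hx => ?_⟩
        obtain ⟨f, rfl, hf⟩ := exists_lt_of_quotientSeminorm_lt hx
        exact hs f hf
    exact mconvex_of_le h fun t => ⟨_, t.2.quotient, 1, fun a => by simp⟩
  complete := by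
    have := hE.topologicalAddGroup
    have := hE.complete.2
    -- First countability is used here: without it, the quotient of a complete group by a closed
    -- subgroup can fail to be complete.
    exact ⟨topologicalAddGroup_quotient,
      QuotientAddGroup.completeSpace_right' E I.toAddSubgroup⟩

end Quotient

/-! ### Estimates for the seminorms `‖·‖^{(w)}`. -/

section WordBounds

variable {A : Type*} [Ring A] [Algebra ℂ A] [TopologicalSpace A] {α : A ≃A[ℂ] A}

lemma tw_zero_apply (a : A) : tw α [0] a = α a := by simp [tw, deg]

lemma tw_one_apply (a : A) : tw α [1] a = α.symm a := by
  have : deg [1] = -1 := by decide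
  simp only [tw, this, zpow_neg, zpow_one]
  rfl

lemma tw_cons (s : Fin 2) (w : Word) (a : A) : tw α (s :: w) a = tw α [s] (tw α w a) :=
  tw_append α [s] w a

lemma continuous_tw_letter (s : Fin 2) : Continuous fun a => tw α [s] a := by
  fin_cases s
  · exact α.continuous.congr fun a => (tw_zero_apply a).symm
  · exact α.symm.continuous.congr fun a => (tw_one_apply a).symm

/-- Directedness replaces the finite supremum in the usual bound by a single member. Enlarging the
constant to at least `1` lets it serve both as a prefactor and as the base of powers `C ^ |w|`. -/
lemma exists_bound {Λ : Type*} [Nonempty Λ] {p : Λ → Seminorm ℂ A}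
    (hp : WithSeminorms p) (hd : Directed (· ≤ ·) p) {q : Seminorm ℂ A} (hq : Continuous q) :
    ∃ (m : Λ) (C : ℝ), 1 ≤ C ∧ ∀ a, q a ≤ C * p m a := by
  obtain ⟨s, C, -, h⟩ := Seminorm.bound_of_continuous hp q hq
  obtain ⟨m, hm⟩ := hd.finset_le s
  have hs : s.sup p ≤ p m := Finset.sup_le hm
  refine ⟨m, C + 1, by simp, fun a => ?_⟩
  have h1 : (0 : ℝ) ≤ C := C.2
  have h2 := apply_nonneg (p m) a
  calc q a ≤ C * (s.sup p) a := h a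
    _ ≤ C * p m a := mul_le_mul_of_nonneg_left (hs a) h1
    _ ≤ (C + 1) * p m a := by linarith

lemma cost_le_pow {p q : Seminorm ℂ A} {C : ℝ} (h : ∀ a, p a ≤ C * q a) (w : Word)
    (x : ℕ → A) : cost p w x ≤ C ^ w.length * cost q w x := by
  unfold cost
  calc _ ≤ ∏ i ∈ Finset.range w.length, C * q (x i) :=
        Finset.prod_le_prod (fun _ _ => apply_nonneg p _) (fun i _ => h _)
    _ = _ := by simp [Finset.prod_mul_distrib]

/-- Each of the `|w|` tensor entries contributes one factor `C`. The empty word is excluded because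
there the constant is `C`, not `C ^ 0`; later bounds therefore carry an additional prefactor `C`. -/
lemma wordNorm_le_pow {p q : Seminorm ℂ A} {C : ℝ} (hC : 0 ≤ C) (h : ∀ a, p a ≤ C * q a)
    {w : Word} (hw : w ≠ []) (r : A) :
    wordNorm α p w r ≤ C ^ w.length * wordNorm α q w r :=
  le_wordNorm α q hw (wordNorm α p w) (wordNorm_zero α p w).le (wordNorm_add_le α p w)
    (pow_nonneg hC _) (fun x => (wordNorm_iw_le α p hw x).trans (cost_le_pow h w x)) r

lemma wordNorm_nil (p : Seminorm ℂ A) (r : A) : wordNorm α p [] r = p r := by simp [wordNorm]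

/-- Each `‖·‖^{(w)}` is continuous for the topology of `A`. -/
lemma exists_wordNorm_le (p : Seminorm ℂ A) (w : Word) :
    ∃ K : ℝ, 0 ≤ K ∧ ∀ r, wordNorm α p w r ≤ K * p r := by
  cases w with
  | nil => exact ⟨1, zero_le_one, fun r => by simp [wordNorm_nil]⟩
  | cons s w =>
    -- The constant comes from the representation `r ⊗ 1 ⊗ ⋯ ⊗ 1`.
    refine ⟨cost p w fun _ => 1, cost_nonneg _ _ _, fun r => ?_⟩
    have h := wordNorm_iw_le α p (List.cons_ne_nil s w) (fun i => if i = 0 then r else 1)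
    rw [iw_single α _ r (List.cons_ne_nil s w), cost_cons] at h
    simpa [mul_comm] using h

/-- The map `i_w` is built from products and `α`, `α⁻¹`, all continuous. Splitting off the first
entry leaves a shorter word inside one twist; the induction must allow `q` to vary because it passes
to `t ∘ α` or `t ∘ α⁻¹`. -/
lemma exists_le_cost (hA : IsArensMichael A) {Λ : Type*} [Nonempty Λ] {p : Λ → Seminorm ℂ A}
    (hp : WithSeminorms p) (hd : Directed (· ≤ ·) p) (w : Word) {q : Seminorm ℂ A}
    (hq : Continuous q) :
    ∃ (m : Λ) (K : ℝ), 0 ≤ K ∧ ∀ x, q (iw α w x) ≤ K * cost (p m) w x := by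
  induction w generalizing q with
  | nil =>
    exact ⟨Classical.arbitrary Λ, q 1, apply_nonneg q 1, fun x => by simp [iw_nil, cost_nil]⟩
  | cons s w ih =>
    obtain ⟨t, ht, C, hC, h⟩ := hA.exists_isMSeminorm hq
    obtain ⟨m₁, C₁, hC₁, h₁⟩ := exists_bound hp hd ht.continuous
    obtain ⟨m₂, K, hK, h₂⟩ := ih (q := t.comp (tw α [s]).toLinearMap)
      (ht.continuous.comp (continuous_tw_letter s))
    obtain ⟨m, hm₁, hm₂⟩ := hd m₁ m₂
    refine ⟨m, C * (C₁ * K), by positivity, fun x => ?_⟩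
    rw [iw_cons, cost_cons]
    have e₁ : t (x 0) ≤ C₁ * p m (x 0) :=
      (h₁ _).trans (mul_le_mul_of_nonneg_left (hm₁ _) (by linarith))
    have e₂ : t (tw α [s] (iw α w fun i => x (i + 1))) ≤ K * cost (p m) w fun i => x (i + 1) :=
      (h₂ _).trans (mul_le_mul_of_nonneg_left
        (Finset.prod_le_prod (fun _ _ => apply_nonneg _ _) fun _ _ => hm₂ _) hK)
    calc _ ≤ C * t (x 0 * tw α [s] (iw α w fun i => x (i + 1))) := h _
      _ ≤ C * ((C₁ * p m (x 0)) * (K * cost (p m) w fun i => x (i + 1))) := by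
          refine mul_le_mul_of_nonneg_left ((ht.mul_le _ _).trans ?_) (by linarith)
          exact mul_le_mul e₁ e₂ (apply_nonneg t _)
            (mul_nonneg (by linarith) (apply_nonneg _ _))
      _ = _ := by ring

/-- The topology of `A` is coarser than the one given by the seminorms `‖·‖^{(w)}`. -/
lemma exists_le_wordNorm (hA : IsArensMichael A) {Λ : Type*} [Nonempty Λ] {p : Λ → Seminorm ℂ A}
    (hp : WithSeminorms p) (hd : Directed (· ≤ ·) p) (w : Word) {q : Seminorm ℂ A}
    (hq : Continuous q) :
    ∃ (m : Λ) (K : ℝ), 0 ≤ K ∧ ∀ r, q r ≤ K * wordNorm α (p m) w r := by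
  by_cases hw : w = []
  · subst hw
    obtain ⟨m, C, hC, h⟩ := exists_bound hp hd hq
    exact ⟨m, C, by linarith, fun r => by rw [wordNorm_nil]; exact h r⟩
  · obtain ⟨m, K, hK, h⟩ := exists_le_cost (α := α) hA hp hd w hq
    exact ⟨m, K, hK, le_wordNorm α (p m) hw q (map_zero q).le (map_add_le_add q) hK h⟩

variable (α) in
/-- The seminorm `t + t ∘ α + t ∘ α⁻¹`. -/
noncomputable def twSum (t : Seminorm ℂ A) : Seminorm ℂ A :=
  t + t.comp (tw α [0]).toLinearMap + t.comp (tw α [1]).toLinearMap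

lemma twSum_apply (t : Seminorm ℂ A) (a : A) :
    twSum α t a = t a + t (tw α [0] a) + t (tw α [1] a) := rfl

lemma le_twSum (t : Seminorm ℂ A) (a : A) : t a ≤ twSum α t a := by
  have h0 := apply_nonneg t (tw α [0] a)
  have h1 := apply_nonneg t (tw α [1] a)
  rw [twSum_apply]; linarith

lemma tw_le_twSum (t : Seminorm ℂ A) (s : Fin 2) (a : A) : t (tw α [s] a) ≤ twSum α t a := by
  have h := apply_nonneg t a
  have h0 := apply_nonneg t (tw α [0] a)
  have h1 := apply_nonneg t (tw α [1] a)
  rw [twSum_apply]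
  fin_cases s
  · change t (tw α [0] a) ≤ _; linarith
  · change t (tw α [1] a) ≤ _; linarith

namespace IsMSeminorm

variable {t : Seminorm ℂ A} (ht : IsMSeminorm t)
include ht

lemma twSum : IsMSeminorm (twSum α t) :=
  (ht.add (ht.comp (φ := (tw α [0]).toAlgHom) (continuous_tw_letter 0))).add
    (ht.comp (φ := (tw α [1]).toAlgHom) (continuous_tw_letter 1))

/-- If `w` ends in the letter `s`, then `α^{c(w)}(b)` is the twist of the last entry applied to `tw
α [s] b`. Hence `b` is absorbed by multiplying the last entry by `α(b)` or `α⁻¹(b)`, and `twSum`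
bounds both possibilities. -/
lemma exists_right (b : A) {w : Word} (hw : w ≠ []) (x : ℕ → A) :
    ∃ z : ℕ → A, iw α w z = iw α w x * tw α w b ∧
      cost t w z ≤ LaurentTensor.twSum α t b * cost t w x := by
  induction w generalizing x with
  | nil => exact absurd rfl hw
  | cons s w ih =>
    by_cases hw' : w = []
    · subst hw'
      refine ⟨fun _ => x 0 * tw α [s] b, by simp [iw_cons, iw_nil], ?_⟩
      simp only [cost_cons, cost_nil, mul_one]
      rw [mul_comm]
      exact (ht.mul_le _ _).trans
        (mul_le_mul_of_nonneg_left (tw_le_twSum t s b) (apply_nonneg t _))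
    · obtain ⟨z, h1, h2⟩ := ih hw' (fun i => x (i + 1))
      refine ⟨fun i => if i = 0 then x 0 else z (i - 1), ?_, ?_⟩
      · simp [iw_cons, h1, tw_cons s w, mul_assoc]
      · simp only [cost_cons, ↓reduceIte, Nat.add_eq_zero_iff, one_ne_zero, and_false,
          Nat.add_sub_cancel]
        exact (mul_le_mul_of_nonneg_left h2 (apply_nonneg t _)).trans (le_of_eq (by ring))

lemma wordNorm_mul_left_le (a b : A) {w : Word} (hw : w ≠ []) :
    wordNorm α t w (a * b) ≤ t a * wordNorm α t w b := by
  refine le_wordNorm α t hw (fun b => wordNorm α t w (a * b)) (by simp [wordNorm_zero])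
    (fun b c => by rw [mul_add]; exact wordNorm_add_le α t w _ _) (apply_nonneg t a)
    (fun x => ?_) b
  obtain ⟨s, w, rfl⟩ := List.exists_cons_of_ne_nil hw
  have h := wordNorm_iw_le α t hw (fun i => if i = 0 then a * x 0 else x i)
  simp only [iw_cons, cost_cons, ↓reduceIte, Nat.add_eq_zero_iff, one_ne_zero, and_false,
    mul_assoc] at h ⊢
  refine h.trans ?_
  rw [← mul_assoc]
  exact mul_le_mul_of_nonneg_right (ht.mul_le _ _) (cost_nonneg _ _ _)

lemma wordNorm_mul_right_le (a b : A) {w : Word} (hw : w ≠ []) :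
    wordNorm α t w (a * tw α w b) ≤ LaurentTensor.twSum α t b * wordNorm α t w a := by
  refine le_wordNorm α t hw (fun a => wordNorm α t w (a * tw α w b)) (by simp [wordNorm_zero])
    (fun b c => by rw [add_mul]; exact wordNorm_add_le α t w _ _) (apply_nonneg _ b)
    (fun x => ?_) a
  obtain ⟨z, h1, h2⟩ := ht.exists_right b hw x
  rw [← h1]
  exact (wordNorm_iw_le α t hw z).trans h2

omit ht in
-- Concatenating the tensors multiplies their costs exactly, so `t` need not be submultiplicative.
-- The bound for elementary tensors is extended to one factor at a time through `le_wordNorm`.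
lemma wordNorm_append_le (t : Seminorm ℂ A) (a b : A) {u v : Word} (hu : u ≠ []) (hv : v ≠ []) :
    wordNorm α t (u ++ v) (a * tw α u b) ≤ wordNorm α t u a * wordNorm α t v b := by
  rw [mul_comm]
  refine le_wordNorm α t hu (fun a => wordNorm α t (u ++ v) (a * tw α u b))
    (by simp [wordNorm_zero]) (fun b c => by rw [add_mul]; exact wordNorm_add_le α t _ _ _)
    (wordNorm_nonneg α t v b) (fun x => ?_) a
  rw [mul_comm]
  refine le_wordNorm α t hv (fun b => wordNorm α t (u ++ v) (iw α u x * tw α u b))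
    (by simp [wordNorm_zero])
    (fun b c => by rw [map_add, mul_add]; exact wordNorm_add_le α t _ _ _)
    (cost_nonneg t u x) (fun y => ?_) b
  obtain ⟨z, h1, h2⟩ := exists_append (α := α) u v x y
  rw [← h1, ← h2 t]
  exact wordNorm_iw_le α t (by simp [hu]) z

end IsMSeminorm

variable (α) in
/-- The seminorm on the coefficient of `x^w` that enters in a submultiplicative seminorm on
`A{x₁, x₂; α}`. -/
noncomputable def coeffSeminorm (t : Seminorm ℂ A) (ρ : ℝ≥0) (w : Word) : Seminorm ℂ A :=
  if w = [] then twSum α t else ρ ^ w.length • wordSeminorm α t w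

lemma coeffSeminorm_nil (t : Seminorm ℂ A) (ρ : ℝ≥0) : coeffSeminorm α t ρ [] = twSum α t :=
  if_pos rfl

lemma coeffSeminorm_apply (t : Seminorm ℂ A) (ρ : ℝ≥0) {w : Word} (hw : w ≠ []) (a : A) :
    coeffSeminorm α t ρ w a = ρ ^ w.length * wordNorm α t w a := by
  rw [coeffSeminorm, if_neg hw]
  rfl

/-- A constant on the left is absorbed by the first entry and costs only `t`; a constant on the
right is absorbed by the last entry and needs `twSum`. Two constants are handled by the
submultiplicativity of `twSum` itself, two nonempty words by concatenation. -/
lemma IsMSeminorm.coeffSeminorm_mul_le {t : Seminorm ℂ A} (ht : IsMSeminorm t) (ρ : ℝ≥0)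
    (u v : Word) (a b : A) : coeffSeminorm α t ρ (u ++ v) (a * tw α u b) ≤
      coeffSeminorm α t ρ u a * coeffSeminorm α t ρ v b := by
  by_cases hu : u = []
  · subst hu
    rw [List.nil_append, tw_nil, coeffSeminorm_nil]
    by_cases hv : v = []
    · subst hv
      rw [coeffSeminorm_nil]
      exact ht.twSum.mul_le a b
    · rw [coeffSeminorm_apply t ρ hv, coeffSeminorm_apply t ρ hv, mul_left_comm]
      refine mul_le_mul_of_nonneg_left ((ht.wordNorm_mul_left_le a b hv).trans ?_) (by positivity)
      exact mul_le_mul_of_nonneg_right (le_twSum t a) (wordNorm_nonneg _ _ _ _)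
  · by_cases hv : v = []
    · subst hv
      rw [List.append_nil, coeffSeminorm_nil, coeffSeminorm_apply t ρ hu,
        coeffSeminorm_apply t ρ hu, mul_assoc]
      refine mul_le_mul_of_nonneg_left ((ht.wordNorm_mul_right_le a b hu).trans ?_)
        (by positivity)
      rw [mul_comm]
    · rw [coeffSeminorm_apply t ρ hu, coeffSeminorm_apply t ρ hv,
        coeffSeminorm_apply t ρ (by simp [hu]), List.length_append, pow_add]
      refine (mul_le_mul_of_nonneg_left (IsMSeminorm.wordNorm_append_le t a b hu hv)
        (by positivity)).trans (le_of_eq (by ring))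

lemma IsMSeminorm.exists_coeffSeminorm_le {Λ : Type*} [Nonempty Λ]
    {p : Λ → Seminorm ℂ A} (hp : WithSeminorms p) (hd : Directed (· ≤ ·) p)
    {t : Seminorm ℂ A} (ht : IsMSeminorm t) {ρ : ℝ≥0} (hρ : 0 < ρ) :
    ∃ (m : Λ) (C : ℝ) (σ : ℝ), 0 ≤ C ∧ 0 < σ ∧ ∀ w a,
      coeffSeminorm α t ρ w a ≤ C * (wordSeminorm α (p m) w a * σ ^ w.length) := by
  obtain ⟨m, C, hC, h⟩ := exists_bound hp hd (ht.twSum (α := α)).continuous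
  -- The radius `C * ρ` absorbs one `C` per letter; the prefactor `C` is there for the empty word.
  refine ⟨m, C, C * ρ, by linarith, by positivity, fun w a => ?_⟩
  rw [wordSeminorm_apply]
  by_cases hw : w = []
  · subst hw
    simpa [wordNorm_nil, coeffSeminorm_nil] using h a
  · rw [coeffSeminorm_apply t ρ hw, mul_pow]
    have h1 : wordNorm α t w a ≤ C ^ w.length * wordNorm α (p m) w a :=
      wordNorm_le_pow (by linarith) (fun a => (le_twSum t a).trans (h a)) hw a
    have h2 : 0 ≤ C ^ w.length * wordNorm α (p m) w a :=
      mul_nonneg (pow_nonneg (by linarith) _) (wordNorm_nonneg _ _ _ _)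
    calc _ ≤ (ρ : ℝ) ^ w.length * (C ^ w.length * wordNorm α (p m) w a) :=
          mul_le_mul_of_nonneg_left h1 (by positivity)
      _ ≤ C * ((ρ : ℝ) ^ w.length * (C ^ w.length * wordNorm α (p m) w a)) :=
          le_mul_of_one_le_left (by positivity) hC
      _ = _ := by ring

lemma wordSeminorm_mul_pow_le_coeffSeminorm {p t : Seminorm ℂ A} {C : ℝ≥0} (hC : 1 ≤ C)
    (h : ∀ a, p a ≤ C * t a) (ρ : ℝ≥0) (w : Word) (a : A) :
    wordSeminorm α p w a * (ρ : ℝ) ^ w.length ≤ C * coeffSeminorm α t (C * ρ) w a := by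
  rw [wordSeminorm_apply]
  have hC' : (1 : ℝ) ≤ C := by exact_mod_cast hC
  by_cases hw : w = []
  · subst hw
    simp only [wordNorm_nil, coeffSeminorm_nil, List.length_nil, pow_zero, mul_one]
    exact (h a).trans (mul_le_mul_of_nonneg_left (le_twSum t a) C.2)
  · rw [coeffSeminorm_apply t _ hw, NNReal.coe_mul, mul_pow]
    have h1 : wordNorm α p w a ≤ (C : ℝ) ^ w.length * wordNorm α t w a :=
      wordNorm_le_pow C.2 h hw a
    have h2 := wordNorm_nonneg α t w a
    calc _ ≤ ((C : ℝ) ^ w.length * wordNorm α t w a) * (ρ : ℝ) ^ w.length :=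
          mul_le_mul_of_nonneg_right h1 (by positivity)
      _ ≤ C * (((C : ℝ) ^ w.length * wordNorm α t w a) * (ρ : ℝ) ^ w.length) :=
          le_mul_of_one_le_left (by positivity) hC'
      _ = _ := by ring

end WordBounds

/-! ### The series algebra `A{x₁, x₂; α}` is an Arens-Michael algebra. -/

section EntireSeries

variable {A : Type*} [Ring A] [Algebra ℂ A] [TopologicalSpace A]
  {Λ : Type*} {p : Λ → Seminorm ℂ A} [Nonempty Λ] (hA : IsArensMichael A) (hp : WithSeminorms p)
  (hd : Directed (· ≤ ·) p) (α : A ≃A[ℂ] A)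

lemma withSeminorms_entireSeminorm : WithSeminorms (entireSeminorm hA hp hd α) := ⟨rfl⟩

instance : IsTopologicalAddGroup (EntireSeries hA hp hd α) :=
  (withSeminorms_entireSeminorm hA hp hd α).topologicalAddGroup

instance : ContinuousSMul ℂ (EntireSeries hA hp hd α) :=
  (withSeminorms_entireSeminorm hA hp hd α).continuousSMul

variable {hA hp hd α}

lemma entireSeminorm_apply (i : Λ × {ρ : ℝ // 0 < ρ}) (f : EntireSeries hA hp hd α) :
    entireSeminorm hA hp hd α i f =
      ∑' w : Word, wordSeminorm α (p i.1) w (f.1.coeff w) * (i.2 : ℝ) ^ w.length := rfl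

lemma le_entireSeminorm (i : Λ × {ρ : ℝ // 0 < ρ}) (f : EntireSeries hA hp hd α) (w : Word) :
    wordSeminorm α (p i.1) w (f.1.coeff w) * (i.2 : ℝ) ^ w.length ≤
      entireSeminorm hA hp hd α i f :=
  (f.2 i.1 i.2 i.2.2).le_tsum w fun _ _ =>
    mul_nonneg (apply_nonneg _ _) (pow_nonneg i.2.2.le _)

/-- A family of seminorms on the coefficients that is bounded by one of the families defining
`‖·‖_{λ, ρ}`. -/
def IsCoeffBounded (p : Λ → Seminorm ℂ A) (α : A ≃A[ℂ] A) (s : Word → Seminorm ℂ A) : Prop :=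
  ∃ (m : Λ) (C : ℝ) (σ : ℝ), 0 ≤ C ∧ 0 < σ ∧ ∀ w a,
    s w a ≤ C * (wordSeminorm α (p m) w a * σ ^ w.length)

namespace IsCoeffBounded

variable {s : Word → Seminorm ℂ A} (hs : IsCoeffBounded p α s)
include hs

lemma summable (f : EntireSeries hA hp hd α) : Summable fun w => s w (f.1.coeff w) := by
  obtain ⟨m, C, σ, hC, hσ, h⟩ := hs
  exact .of_nonneg_of_le (fun w => apply_nonneg _ _) (fun w => h w _) ((f.2 m σ hσ).mul_left C)

variable (hA hp hd) in
/-- The seminorm `∑ s_w(a_w)` on `A{x₁, x₂; α}`. -/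
noncomputable def seminorm : Seminorm ℂ (EntireSeries hA hp hd α) :=
  Seminorm.ofSMulLE (fun f => ∑' w : Word, s w (f.1.coeff w))
    (by simp)
    (fun f g => by
      rw [← (hs.summable f).tsum_add (hs.summable g)]
      exact (hs.summable (f + g)).tsum_le_tsum (fun w => map_add_le_add _ _ _)
        ((hs.summable f).add (hs.summable g)))
    (fun c f => by
      rw [← tsum_mul_left]
      exact le_of_eq (tsum_congr fun w => map_smul_eq_mul (s w) c (f.1.coeff w)))

lemma seminorm_apply (f : EntireSeries hA hp hd α) :
    hs.seminorm hA hp hd f = ∑' w : Word, s w (f.1.coeff w) := rfl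

lemma continuous_seminorm : Continuous (hs.seminorm hA hp hd) := by
  obtain ⟨m, C, σ, hC, hσ, h⟩ := id hs
  have hc := ((withSeminorms_entireSeminorm hA hp hd α).continuous_seminorm
    (m, ⟨σ, hσ⟩)).const_smul C
  refine Seminorm.continuous_of_le
    (q := C.toNNReal • entireSeminorm hA hp hd α (m, ⟨σ, hσ⟩)) ?_ fun f => ?_
  · refine hc.congr fun f => ?_
    simp [NNReal.smul_def, hC]
  · simp only [_root_.smul_apply, NNReal.smul_def, Real.coe_toNNReal C hC, smul_eq_mul,
      entireSeminorm_apply, seminorm_apply]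
    rw [← tsum_mul_left]
    exact (hs.summable f).tsum_le_tsum (fun w => h w _) ((f.2 m σ hσ).mul_left C)

lemma isMSeminorm (hm : ∀ u v a b, s (u ++ v) (a * tw α u b) ≤ s u a * s v b) :
    IsMSeminorm (hs.seminorm hA hp hd) where
  continuous := hs.continuous_seminorm
  mul_le f g := by
    -- The cuts of a word into prefix and suffix index the terms of the convolution. Since the
    -- double series has nonnegative terms, injectivity of this indexing suffices to bound the
    -- convolution by the product of the two sums.
    let e : (Σ w : Word, Fin (w.length + 1)) → Word × Word :=
      fun x => (x.1.take x.2, x.1.drop x.2)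
    have he : Function.Injective e := by
      rintro ⟨w, k, hk⟩ ⟨w', k', hk'⟩ hee
      simp only [e, Prod.mk.injEq] at hee
      obtain ⟨h1, h2⟩ := hee
      have hw : w = w' := by rw [← List.take_append_drop k w, h1, h2, List.take_append_drop]
      subst hw
      have := congrArg List.length h1
      simp only [List.length_take] at this
      have hkk : k = k' := by omega
      subst hkk
      rfl
    have hfg := (hs.summable f).mul_of_nonneg (hs.summable g) (fun w => apply_nonneg _ _)
      (fun w => apply_nonneg _ _)
    have hse := hfg.comp_injective he
    simp only [seminorm_apply]
    rw [(hs.summable f).tsum_mul_tsum (hs.summable g) hfg]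
    refine le_trans ?_ (tsum_comp_le_tsum_of_inj hfg
      (fun x => mul_nonneg (apply_nonneg _ _) (apply_nonneg _ _)) he)
    rw [hse.tsum_sigma]
    refine (hs.summable (f * g)).tsum_le_tsum (fun w => ?_) hse.sigma
    rw [tsum_fintype]
    change s w ((f.1 * g.1).coeff w) ≤ _
    rw [FormalSeries.coeff_mul, Finset.sum_range]
    refine (seminorm_sum_le _ _ _).trans (Finset.sum_le_sum fun k _ => ?_)
    have := hm (w.take k) (w.drop k) (f.1.coeff (w.take k)) (g.1.coeff (w.drop k))
    rwa [List.take_append_drop] at this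

end IsCoeffBounded

lemma exists_isMSeminorm_entire (i : Λ × {ρ : ℝ // 0 < ρ}) :
    ∃ t : Seminorm ℂ (EntireSeries hA hp hd α), IsMSeminorm t ∧
      ∃ C : ℝ, ∀ f, entireSeminorm hA hp hd α i f ≤ C * t f := by
  obtain ⟨l, ρ, hρ⟩ := i
  obtain ⟨t, ht, C, hC, h⟩ := hA.exists_isMSeminorm (hp.continuous_seminorm l)
  lift C to ℝ≥0 using by linarith
  lift ρ to ℝ≥0 using hρ.le
  have hC : 1 ≤ C := by exact_mod_cast hC
  have hρ' : 0 < ρ := by exact_mod_cast hρ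
  have hs : IsCoeffBounded p α (coeffSeminorm α t (C * ρ)) :=
    ht.exists_coeffSeminorm_le hp hd (mul_pos (zero_lt_one.trans_le hC) hρ')
  refine ⟨hs.seminorm hA hp hd, hs.isMSeminorm (ht.coeffSeminorm_mul_le _), C, fun f => ?_⟩
  rw [entireSeminorm_apply, IsCoeffBounded.seminorm_apply, ← tsum_mul_left]
  exact (f.2 l ρ hρ).tsum_le_tsum
    (fun w => wordSeminorm_mul_pow_le_coeffSeminorm hC h ρ w _) ((hs.summable f).mul_left _)

variable (hA hp hd α) in
/-- The `w`-th coefficient as a linear map. -/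
def coeffLinear (w : Word) : EntireSeries hA hp hd α →ₗ[ℂ] A where
  toFun f := f.1.coeff w
  map_add' _ _ := rfl
  map_smul' _ _ := rfl

lemma continuous_coeffLinear (w : Word) : Continuous (coeffLinear hA hp hd α w) := by
  refine WithSeminorms.continuous_of_isBounded (withSeminorms_entireSeminorm hA hp hd α) hp _
    (Seminorm.IsBounded.of_real fun l => ?_)
  obtain ⟨m, K, hK, h⟩ := exists_le_wordNorm (α := α) hA hp hd w (hp.continuous_seminorm l)
  -- At radius `1` the weight `ρ ^ |w|` disappears.
  refine ⟨{(m, ⟨1, one_pos⟩)}, K, fun f => ?_⟩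
  have := le_entireSeminorm (m, ⟨1, one_pos⟩) f w
  simp only [one_pow, mul_one] at this
  rw [Finset.sup_singleton]
  exact (h _).trans (mul_le_mul_of_nonneg_left this hK)

lemma continuous_wordSeminorm (hA : IsArensMichael A) {q : Seminorm ℂ A} (hq : Continuous q)
    (w : Word) : Continuous (wordSeminorm α q w) := by
  obtain ⟨K, hK, h⟩ := exists_wordNorm_le (α := α) q w
  have := hA.topologicalAddGroup
  refine Seminorm.continuous_of_le (q := K.toNNReal • q) ?_ fun r => ?_
  · exact (hq.const_smul K).congr fun r => by simp [NNReal.smul_def, hK]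
  · simpa [NNReal.smul_def, hK, wordSeminorm_apply] using h r

/-- A countable subfamily of a directed family defining a first countable topology suffices. -/
lemma exists_countable_cofinal [FirstCountableTopology A] (hp : WithSeminorms p)
    (hd : Directed (· ≤ ·) p) :
    ∃ m : ℕ → Λ, ∀ l, ∃ (k : ℕ) (C : ℝ), 1 ≤ C ∧ ∀ a, p l a ≤ C * p (m k) a := by
  obtain ⟨U, hU⟩ := (𝓝 (0 : A)).exists_antitone_basis
  have h1 : ∀ k, ∃ (m : Λ) (r : ℝ), 0 < r ∧ (p m).ball 0 r ⊆ U k := by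
    intro k
    obtain ⟨s, r, hr, hs⟩ := (hp.mem_nhds_iff 0 (U k)).1 (hU.1.mem_of_mem trivial)
    obtain ⟨m, hm⟩ := hd.finset_le s
    exact ⟨m, r, hr, (Seminorm.ball_antitone (Finset.sup_le hm)).trans hs⟩
  choose m r hr hm using h1
  have := hp.topologicalAddGroup
  have hq : WithSeminorms fun k => p (m k) := by
    rw [SeminormFamily.withSeminorms_iff_nhds_eq_iInf]
    refine le_antisymm (le_iInf fun k => ?_) fun V hV => ?_
    · have := (hp.continuous_seminorm (m k)).tendsto 0
      rw [map_zero] at this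
      exact this.le_comap
    · obtain ⟨k, -, hk⟩ := hU.1.mem_iff.1 hV
      exact mem_iInf_of_mem k ⟨Set.Iio (r k), gt_mem_nhds (hr k), fun a ha =>
        hk (hm k ((Seminorm.mem_ball_zero _).2 ha))⟩
  -- The chosen members need not form a directed family. Each finite set of them is therefore
  -- dominated by a further member of `p`, and there are only countably many finite sets of indices.
  have hd' : ∀ s : Finset ℕ, ∃ n, ∀ k ∈ s, p (m k) ≤ p n := fun s => by
    classical
    obtain ⟨n, hn⟩ := hd.finset_le (s.image m)
    exact ⟨n, fun k hk => hn _ (Finset.mem_image_of_mem m hk)⟩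
  choose n hn using hd'
  -- The finite sets are enumerated by their codes; the default `∅` plays no role, since only codes
  -- of actual sets are used below.
  refine ⟨fun k => n ((Encodable.decode k : Option (Finset ℕ)).getD ∅), fun l => ?_⟩
  obtain ⟨s, C, -, h⟩ := Seminorm.bound_of_continuous hq (p l) (hp.continuous_seminorm l)
  have hs : s.sup (fun k => p (m k)) ≤ p (n s) := Finset.sup_le (hn s)
  have hC : (0 : ℝ) ≤ C := C.2
  refine ⟨Encodable.encode s, C + 1, by linarith, fun a => ?_⟩
  have := apply_nonneg (p (n s)) a
  simp only [Encodable.encodek, Option.getD_some]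
  calc p l a ≤ C * _ := h a
    _ ≤ C * p (n s) a := mul_le_mul_of_nonneg_left (hs a) hC
    _ ≤ _ := by linarith

lemma firstCountableTopology_entireSeries [FirstCountableTopology A] :
    FirstCountableTopology (EntireSeries hA hp hd α) := by
  obtain ⟨m, hm⟩ := exists_countable_cofinal hp hd
  have h := withSeminorms_entireSeminorm hA hp hd α
  have hq : WithSeminorms fun i : ℕ × ℕ =>
      entireSeminorm hA hp hd α (m i.1, ⟨(i.2 : ℝ) + 1, by positivity⟩) := by
    refine h.congr ?_ ?_
    · exact fun i => ⟨{(m i.1, ⟨(i.2 : ℝ) + 1, by positivity⟩)}, 1, fun f => by simp⟩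
    · refine Seminorm.IsBounded.of_real fun ⟨l, ρ, hρ⟩ => ?_
      obtain ⟨k, C, hC, hk⟩ := hm l
      -- The bound `p l ≤ C * p (m k)` gives `C ^ |w|` on words of length `|w|`, so any integer
      -- radius above `C * ρ` works; `n + 1` is also positive.
      obtain ⟨n, hn⟩ := exists_nat_ge (C * ρ)
      refine ⟨{(k, n)}, C, fun f => ?_⟩
      simp only [LinearMap.id_coe, id_eq, Finset.sup_singleton, entireSeminorm_apply]
      rw [← tsum_mul_left]
      refine (f.2 l ρ hρ).tsum_le_tsum (fun w => ?_)
        ((f.2 (m k) ((n : ℝ) + 1) (by positivity)).mul_left C)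
      have hw := wordNorm_nonneg α (p (m k)) w (f.1.coeff w)
      simp only [wordSeminorm_apply]
      have hle : wordNorm α (p l) w (f.1.coeff w) ≤
          C * (C ^ w.length * wordNorm α (p (m k)) w (f.1.coeff w)) := by
        by_cases hw' : w = []
        · subst hw'
          simpa [wordNorm_nil] using hk _
        · exact (wordNorm_le_pow (by linarith) hk hw' _).trans
            (le_mul_of_one_le_left (by positivity) hC)
      calc _ ≤ C * (C ^ w.length * wordNorm α (p (m k)) w (f.1.coeff w)) * ρ ^ w.length :=
            mul_le_mul_of_nonneg_right hle (by positivity)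
        _ = C * (wordNorm α (p (m k)) w (f.1.coeff w) * (C * ρ) ^ w.length) := by
            rw [mul_pow]; ring
        _ ≤ _ := by gcongr; linarith
  exact hq.firstCountableTopology

lemma entireSeries_ext {f g : EntireSeries hA hp hd α} (h : ∀ w, f.1.coeff w = g.1.coeff w) :
    f = g := Subtype.ext (FormalSeries.ext (funext h))

lemma t2Space_entireSeries : T2Space (EntireSeries hA hp hd α) := by
  have := hA.t2
  refine ⟨fun f g hfg => ?_⟩
  obtain ⟨w, hw⟩ : ∃ w, f.1.coeff w ≠ g.1.coeff w := by
    by_contra! h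
    exact hfg (entireSeries_ext h)
  exact separated_by_continuous (continuous_coeffLinear w) hw

/-- This is the completeness argument for `ℓ¹`. Coefficients converge because the coefficient maps
are continuous; the Cauchy estimate on finite sets of words passes to the limit because each
`‖·‖^{(w)}` is continuous on `A`, and its uniformity in the finite set bounds the whole series. -/
lemma completeSpace_entireSeries :
    @CompleteSpace (EntireSeries hA hp hd α) (IsTopologicalAddGroup.rightUniformSpace _) := by
  obtain ⟨hg, hcA⟩ := hA.complete
  let : UniformSpace A := IsTopologicalAddGroup.rightUniformSpace A
  have : IsUniformAddGroup A := isUniformAddGroup_of_addCommGroup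
  have : CompleteSpace A := hcA
  let : UniformSpace (EntireSeries hA hp hd α) := IsTopologicalAddGroup.rightUniformSpace _
  have : IsUniformAddGroup (EntireSeries hA hp hd α) := isUniformAddGroup_of_addCommGroup
  have hE := withSeminorms_entireSeminorm hA hp hd α
  refine ⟨fun {F} hF => ?_⟩
  have hne := hF.1
  have hlim : ∀ w, ∃ a, Tendsto (coeffLinear hA hp hd α w) F (𝓝 a) := fun w =>
    CompleteSpace.complete (hF.map (uniformContinuous_addMonoidHom_of_continuous
      (f := (coeffLinear hA hp hd α w).toAddMonoidHom) (continuous_coeffLinear w)))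
  choose a ha using hlim
  have hF2 := ((IsUniformAddGroup.cauchy_iff_tendsto F).1 hF).2
  have key : ∀ i : Λ × {ρ : ℝ // 0 < ρ}, ∀ ε > 0, ∀ᶠ f in F, ∀ s : Finset Word,
      ∑ w ∈ s, wordSeminorm α (p i.1) w (f.1.coeff w - a w) * (i.2 : ℝ) ^ w.length ≤ ε := by
    intro i ε hε
    have h1 := (hE.tendsto_nhds _ 0).1 hF2 i ε hε
    -- For a fixed `f` close to most `g`, the limit is taken in `g`.
    refine h1.curry.mono fun f hf s => ?_
    have h2 : Tendsto (fun g : EntireSeries hA hp hd α =>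
        ∑ w ∈ s, wordSeminorm α (p i.1) w (f.1.coeff w - coeffLinear hA hp hd α w g) *
          (i.2 : ℝ) ^ w.length) F
        (𝓝 (∑ w ∈ s, wordSeminorm α (p i.1) w (f.1.coeff w - a w) * (i.2 : ℝ) ^ w.length)) :=
      tendsto_finsetSum _ fun w _ =>
        (((continuous_wordSeminorm hA (hp.continuous_seminorm i.1) w).tendsto _).comp
          (tendsto_const_nhds.sub (ha w))).mul_const _
    refine le_of_tendsto h2 (hf.mono fun g hg => ?_)
    have h3 : ∑ w ∈ s, wordSeminorm α (p i.1) w ((f - g).1.coeff w) * (i.2 : ℝ) ^ w.length ≤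
        entireSeminorm hA hp hd α i (f - g) :=
      ((f - g).2 i.1 i.2 i.2.2).sum_le_tsum s fun w _ =>
        mul_nonneg (apply_nonneg _ _) (pow_nonneg i.2.2.le _)
    simp only [sub_zero] at hg
    exact h3.trans hg.le
  have hdiff : ∀ i : Λ × {ρ : ℝ // 0 < ρ}, ∀ ε > 0, ∀ᶠ f in F,
      Summable (fun w : Word =>
        wordSeminorm α (p i.1) w (f.1.coeff w - a w) * (i.2 : ℝ) ^ w.length) ∧
      ∑' w : Word, wordSeminorm α (p i.1) w (f.1.coeff w - a w) * (i.2 : ℝ) ^ w.length ≤ ε := by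
    intro i ε hε
    filter_upwards [key i ε hε] with f hf
    have hs : Summable fun w : Word =>
        wordSeminorm α (p i.1) w (f.1.coeff w - a w) * (i.2 : ℝ) ^ w.length :=
      summable_of_sum_le (fun w => mul_nonneg (apply_nonneg _ _) (pow_nonneg i.2.2.le _)) hf
    exact ⟨hs, hs.tsum_le_of_sum_le hf⟩
  have hent : IsEntire p (⟨a⟩ : FormalSeries α) := by
    intro l ρ hρ
    -- One series `f` within distance `1` of the limit is enough: the limit is `f` plus a summable
    -- difference.
    obtain ⟨f, hf, -⟩ := (hdiff (l, ⟨ρ, hρ⟩) 1 one_pos).exists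
    refine .of_nonneg_of_le (fun w => mul_nonneg (apply_nonneg _ _) (pow_nonneg hρ.le _))
      (fun w => ?_) (hf.add (f.2 l ρ hρ))
    rw [← add_mul]
    refine mul_le_mul_of_nonneg_right ?_ (pow_nonneg hρ.le _)
    have := map_add_le_add (wordSeminorm α (p l) w) (a w - f.1.coeff w) (f.1.coeff w)
    rwa [sub_add_cancel, map_sub_rev] at this
  refine ⟨⟨⟨a⟩, hent⟩, (hE.tendsto_nhds (fun f => f) _).2 fun i ε hε => ?_⟩
  filter_upwards [hdiff i (ε / 2) (half_pos hε)] with f hf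
  exact lt_of_le_of_lt hf.2 (half_lt_self hε)

theorem isArensMichael_entireSeries : IsArensMichael (EntireSeries hA hp hd α) where
  t2 := t2Space_entireSeries
  mconvex := mconvex_of_le (withSeminorms_entireSeminorm hA hp hd α) exists_isMSeminorm_entire
  complete := ⟨inferInstance, completeSpace_entireSeries⟩

end EntireSeries

/-! ### Expansion into monomials. -/

section Monomials

variable {A : Type*} [Ring A] [Algebra ℂ A] [TopologicalSpace A]
  {Λ : Type*} {p : Λ → Seminorm ℂ A} [Nonempty Λ] (hA : IsArensMichael A) (hp : WithSeminorms p)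
  (hd : Directed (· ≤ ·) p) (α : A ≃A[ℂ] A)

/-- The map `a ↦ a x^w`. -/
noncomputable def monoLinear (w : Word) : A →ₗ[ℂ] EntireSeries hA hp hd α where
  toFun := mono hA hp hd α w
  map_add' a b := entireSeries_ext fun u => by
    change (FormalSeries.monomial w (a + b) : FormalSeries α).coeff u =
      (FormalSeries.monomial w a : FormalSeries α).coeff u +
        (FormalSeries.monomial w b : FormalSeries α).coeff u
    simp only [FormalSeries.coeff_monomial]
    split_ifs <;> simp
  map_smul' c a := entireSeries_ext fun u => by
    change (FormalSeries.monomial w (c • a) : FormalSeries α).coeff u =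
      c • (FormalSeries.monomial w a : FormalSeries α).coeff u
    simp only [FormalSeries.coeff_monomial]
    split_ifs <;> simp

variable {hA hp hd α}

lemma coeff_mono (w u : Word) (a : A) :
    (mono hA hp hd α w a).1.coeff u = if u = w then a else 0 := rfl

lemma mono_mul_mono (u v : Word) (a b : A) :
    mono hA hp hd α u a * mono hA hp hd α v b = mono hA hp hd α (u ++ v) (a * tw α u b) :=
  Subtype.ext (FormalSeries.monomial_mul_monomial u v a b)

lemma mono_nil_one : mono hA hp hd α [] 1 = 1 := rfl

lemma entireSeminorm_mono (i : Λ × {ρ : ℝ // 0 < ρ}) (w : Word) (a : A) :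
    entireSeminorm hA hp hd α i (mono hA hp hd α w a) =
      wordSeminorm α (p i.1) w a * (i.2 : ℝ) ^ w.length := by
  rw [entireSeminorm_apply, tsum_eq_single w fun u hu => by simp [coeff_mono, hu]]
  simp [coeff_mono]

lemma continuous_mono (w : Word) : Continuous (mono hA hp hd α w) := by
  refine WithSeminorms.continuous_of_isBounded hp (withSeminorms_entireSeminorm hA hp hd α)
    (monoLinear hA hp hd α w) (Seminorm.IsBounded.of_real fun i => ?_)
  obtain ⟨K, hK, h⟩ := exists_wordNorm_le (α := α) (p i.1) w
  refine ⟨{i.1}, K * (i.2 : ℝ) ^ w.length, fun a => ?_⟩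
  rw [Finset.sup_singleton]
  refine (entireSeminorm_mono i w a).trans_le ?_
  rw [mul_right_comm]
  exact mul_le_mul_of_nonneg_right (h a) (pow_nonneg i.2.2.le _)

/-- The monomial series is absolutely convergent, as the seminorms of its terms are the terms of
`‖f‖_{λ, ρ}`. Completeness gives some sum, and the continuous coefficient maps identify it with `f`.
-/
lemma hasSum_mono (f : EntireSeries hA hp hd α) :
    HasSum (fun w => mono hA hp hd α w (f.1.coeff w)) f := by
  have hE := withSeminorms_entireSeminorm hA hp hd α
  have hs : Summable fun w => mono hA hp hd α w (f.1.coeff w) := by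
    refine isArensMichael_entireSeries.summable fun t ht => ?_
    obtain ⟨s, C, -, h⟩ := Seminorm.bound_of_continuous hE t ht.continuous
    refine .of_nonneg_of_le (fun w => apply_nonneg _ _) (fun w => (h _).trans
      (mul_le_mul_of_nonneg_left (Seminorm.finset_sup_le_sum _ s _) C.2)) (.mul_left _ ?_)
    have h1 : Summable fun w : Word => ∑ i ∈ s,
        wordSeminorm α (p i.1) w (f.1.coeff w) * (i.2 : ℝ) ^ w.length :=
      summable_sum fun i _ => f.2 i.1 i.2 i.2.2
    refine h1.congr fun w => ?_
    rw [_root_.sum_apply]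
    exact Finset.sum_congr rfl fun i _ => (entireSeminorm_mono i w _).symm
  have := hA.t2
  obtain ⟨g, hg⟩ := hs
  convert hg
  refine entireSeries_ext fun u => ?_
  have h1 : HasSum (fun w => coeffLinear hA hp hd α u (mono hA hp hd α w (f.1.coeff w)))
      (coeffLinear hA hp hd α u g) :=
    hg.map (coeffLinear hA hp hd α u) (continuous_coeffLinear u)
  have h2 : HasSum (fun w => coeffLinear hA hp hd α u (mono hA hp hd α w (f.1.coeff w)))
      (f.1.coeff u) := by
    convert hasSum_single (f := fun w =>
      coeffLinear hA hp hd α u (mono hA hp hd α w (f.1.coeff w))) u fun w hw => ?_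
    · exact (if_pos rfl).symm
    · exact if_neg hw.symm
  exact h2.unique h1

/-- Continuous linear maps on `A{x₁, x₂; α}` are determined by their values on monomials. -/
lemma linearMap_ext_mono {B : Type*} [AddCommGroup B] [Module ℂ B] [TopologicalSpace B] [T2Space B]
    {F G : EntireSeries hA hp hd α →ₗ[ℂ] B} (hF : Continuous F) (hG : Continuous G)
    (h : ∀ w a, F (mono hA hp hd α w a) = G (mono hA hp hd α w a)) : F = G := by
  ext f
  have h1 := (hasSum_mono f).map F hF
  have h2 := (hasSum_mono f).map G hG
  refine h1.unique ?_
  convert h2 using 1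
  exact funext fun w => h w _

lemma algHom_mono {B : Type*} [Ring B] [Algebra ℂ B] (ψ : EntireSeries hA hp hd α →ₐ[ℂ] B)
    (w : Word) (a : A) : ψ (mono hA hp hd α w a) = ψ (mono hA hp hd α [] a) *
      (w.map fun s => ψ (mono hA hp hd α [s] 1)).prod := by
  have h1 : ∀ w : Word, ψ (mono hA hp hd α w 1) =
      (w.map fun s => ψ (mono hA hp hd α [s] 1)).prod := by
    intro w
    induction w with
    | nil => simp [mono_nil_one]
    | cons s w ih =>
      rw [List.map_cons, List.prod_cons, ← ih, ← map_mul, mono_mul_mono]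
      simp
  rw [← h1, ← map_mul, mono_mul_mono]
  simp [tw_nil]

end Monomials

/-! ### Evaluation of series in an Arens-Michael algebra. -/

section Lift

variable {A : Type*} [Ring A] [Algebra ℂ A] [TopologicalSpace A]
  {Λ : Type*} {p : Λ → Seminorm ℂ A} [Nonempty Λ] {hA : IsArensMichael A} {hp : WithSeminorms p}
  {hd : Directed (· ≤ ·) p} {α : A ≃A[ℂ] A}
  {B : Type*} [Ring B] [Algebra ℂ B] [TopologicalSpace B] {θ : A →A[ℂ] B} {y : Fin 2 → B}

lemma prod_mul_eq (hy : ∀ s a, y s * θ a = θ (tw α [s] a) * y s) (w : Word) (a : A) :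
    (w.map y).prod * θ a = θ (tw α w a) * (w.map y).prod := by
  induction w with
  | nil => simp [tw_nil]
  | cons s w ih =>
    rw [List.map_cons, List.prod_cons, mul_assoc, ih, tw_cons, ← mul_assoc, hy, mul_assoc]

/-- `r ↦ t (θ(r) y^w)`. -/
noncomputable def evalSeminorm (θ : A →A[ℂ] B) (y : Fin 2 → B) (t : Seminorm ℂ B) (w : Word) :
    Seminorm ℂ A :=
  t.comp ((LinearMap.mulRight ℂ (w.map y).prod).comp (θ : A →ₐ[ℂ] B).toLinearMap)

lemma evalSeminorm_apply (t : Seminorm ℂ B) (w : Word) (a : A) :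
    evalSeminorm θ y t w a = t (θ a * (w.map y).prod) := rfl

/-- Moving the `y`'s back between the entries undoes the twists: `θ(i_w(x)) y^w` is the alternating
product of the `θ(x_i)` and the letters `y`. Each pair costs `C * D`; the factor `t 1` is the value
at the empty product, which need not be at most `1`. -/
lemma IsMSeminorm.evalSeminorm_iw_le (hy : ∀ s a, y s * θ a = θ (tw α [s] a) * y s)
    {t : Seminorm ℂ B} (ht : IsMSeminorm t) {q : Seminorm ℂ A} {C D : ℝ} (hC : 0 ≤ C)
    (h : ∀ a, t (θ a) ≤ C * q a) (hD : ∀ s, t (y s) ≤ D) (w : Word) (x : ℕ → A) :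
    evalSeminorm θ y t w (iw α w x) ≤ t 1 * (C * D) ^ w.length * cost q w x := by
  have hD0 : 0 ≤ D := (apply_nonneg t _).trans (hD 0)
  induction w generalizing x with
  | nil => simp [evalSeminorm_apply, iw_nil, cost_nil]
  | cons s w ih =>
    have e : θ (iw α (s :: w) x) * ((s :: w).map y).prod =
        θ (x 0) * (y s * (θ (iw α w fun i => x (i + 1)) * (w.map y).prod)) := by
      rw [iw_cons, List.map_cons, List.prod_cons, map_mul, ← mul_assoc (y s), hy]
      simp only [mul_assoc]
    rw [evalSeminorm_apply, e, cost_cons, List.length_cons]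
    have h1 := ih fun i => x (i + 1)
    rw [evalSeminorm_apply] at h1
    have hq : ∀ a, 0 ≤ q a := fun a => apply_nonneg q a
    have ht0 : ∀ b, 0 ≤ t b := fun b => apply_nonneg t b
    calc _ ≤ t (θ (x 0)) * (t (y s) * t (θ (iw α w fun i => x (i + 1)) * (w.map y).prod)) :=
          (ht.mul_le _ _).trans (mul_le_mul_of_nonneg_left (ht.mul_le _ _) (ht0 _))
      _ ≤ (C * q (x 0)) * (D * (t 1 * (C * D) ^ w.length * cost q w fun i => x (i + 1))) :=
          mul_le_mul (h _) (mul_le_mul (hD s) h1 (ht0 _) hD0) (mul_nonneg (ht0 _) (ht0 _))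
            (mul_nonneg hC (hq _))
      _ = _ := by ring

lemma IsMSeminorm.isCoeffBounded_evalSeminorm (hp : WithSeminorms p) (hd : Directed (· ≤ ·) p)
    (hy : ∀ s a, y s * θ a = θ (tw α [s] a) * y s) {t : Seminorm ℂ B} (ht : IsMSeminorm t) :
    IsCoeffBounded p α (evalSeminorm θ y t) := by
  obtain ⟨m, C, hC, h⟩ := exists_bound hp hd (q := t.comp (θ : A →ₐ[ℂ] B).toLinearMap)
    (ht.continuous.comp θ.cont)
  have h : ∀ a, t (θ a) ≤ C * p m a := h
  have hy0 := apply_nonneg t (y 0)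
  have hy1 := apply_nonneg t (y 1)
  -- The summand `1` keeps the bound positive, since it becomes part of the radius.
  have hD : ∀ s, t (y s) ≤ 1 + t (y 0) + t (y 1) := by
    intro s
    fin_cases s
    · change t (y 0) ≤ _; linarith
    · change t (y 1) ≤ _; linarith
  have ht1 := apply_nonneg t 1
  refine ⟨m, t 1 * C, C * (1 + t (y 0) + t (y 1)), by positivity, by positivity, fun w a => ?_⟩
  rw [wordSeminorm_apply]
  by_cases hw : w = []
  · subst hw
    simp only [evalSeminorm_apply, List.map_nil, List.prod_nil, wordNorm_nil, List.length_nil,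
      pow_zero, mul_one]
    have h1 := ht.mul_le 1 (θ a)
    rw [one_mul] at h1
    exact h1.trans (by rw [mul_assoc]; exact mul_le_mul_of_nonneg_left (h a) ht1)
  · have h1 := le_wordNorm α (p m) hw (evalSeminorm θ y t w) (map_zero _).le
      (map_add_le_add _) (by positivity)
      (ht.evalSeminorm_iw_le hy (by linarith) h hD w) a
    have h2 := wordNorm_nonneg α (p m) w a
    refine h1.trans ?_
    calc _ = t 1 * ((C * (1 + t (y 0) + t (y 1))) ^ w.length * wordNorm α (p m) w a) := by ring
      _ ≤ t 1 * (C * ((C * (1 + t (y 0) + t (y 1))) ^ w.length * wordNorm α (p m) w a)) := by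
          exact mul_le_mul_of_nonneg_left (le_mul_of_one_le_left (by positivity) hC) ht1
      _ = _ := by ring

variable (hB : IsArensMichael B) (hy : ∀ s a, y s * θ a = θ (tw α [s] a) * y s)
include hB hy

lemma summable_eval (f : EntireSeries hA hp hd α) :
    Summable fun w : Word => θ (f.1.coeff w) * (w.map y).prod :=
  hB.summable fun _ ht => (ht.isCoeffBounded_evalSeminorm hp hd hy).summable f

/-- The linear map `∑ a_w x^w ↦ ∑ θ(a_w) y^w`. -/
noncomputable def evalLinear : EntireSeries hA hp hd α →ₗ[ℂ] B where
  toFun f := ∑' w : Word, θ (f.1.coeff w) * (w.map y).prod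
  map_add' f g := by
    have := hB.t2
    have := hB.topologicalAddGroup
    rw [← (summable_eval hB hy f).tsum_add (summable_eval hB hy g)]
    refine tsum_congr fun w => ?_
    rw [← add_mul, ← map_add]
    rfl
  map_smul' c f := by
    have := hB.t2
    have := hB.continuousSMul
    rw [RingHom.id_apply, ← (summable_eval hB hy f).tsum_const_smul c]
    refine tsum_congr fun w => ?_
    rw [← smul_mul_assoc, ← map_smul]
    rfl

lemma continuous_evalLinear :
    Continuous (evalLinear hB hy : EntireSeries hA hp hd α →ₗ[ℂ] B) := by
  refine WithSeminorms.continuous_of_continuous_comp hB.withSeminorms _ fun t => ?_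
  have hs := t.2.isCoeffBounded_evalSeminorm hp hd hy
  exact Seminorm.continuous_of_le hs.continuous_seminorm fun f =>
    seminorm_tsum_le t.2.continuous (summable_eval hB hy f) (hs.summable f)

lemma evalLinear_mono (w : Word) (a : A) :
    evalLinear hB hy (mono hA hp hd α w a) = θ a * (w.map y).prod := by
  change ∑' u : Word, θ ((mono hA hp hd α w a).1.coeff u) * (u.map y).prod = _
  rw [tsum_eq_single w fun u hu => by simp [coeff_mono, hu]]
  simp [coeff_mono]

/-- Both sides are continuous and linear in each variable, so monomials suffice: first in `g` with
`f` a monomial, then in `f`. On monomials the identity is the commutation rule `prod_mul_eq`. -/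
lemma evalLinear_mul (f g : EntireSeries hA hp hd α) :
    evalLinear hB hy (f * g) = evalLinear hB hy f * evalLinear hB hy g := by
  have := hB.t2
  have := hB.topologicalRing
  have := (isArensMichael_entireSeries (hA := hA) (hp := hp) (hd := hd) (α := α)).topologicalRing
  have hc := continuous_evalLinear (hA := hA) (hp := hp) (hd := hd) hB hy
  have h1 : ∀ w a, evalLinear hB hy (mono hA hp hd α w a * g) =
      evalLinear hB hy (mono hA hp hd α w a) * evalLinear hB hy g := by
    intro w a
    refine LinearMap.congr_fun (linearMap_ext_mono
      (F := evalLinear hB hy ∘ₗ LinearMap.mulLeft ℂ (mono hA hp hd α w a))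
      (G := LinearMap.mulLeft ℂ (evalLinear hB hy (mono hA hp hd α w a)) ∘ₗ evalLinear hB hy)
      (hc.comp (continuous_const_mul _)) ((continuous_const_mul _).comp hc) fun v b => ?_) g
    simp only [LinearMap.comp_apply, LinearMap.mulLeft_apply]
    rw [mono_mul_mono, evalLinear_mono, evalLinear_mono, evalLinear_mono, List.map_append,
      List.prod_append, map_mul, mul_assoc, mul_assoc, ← mul_assoc (List.prod _) (θ b),
      prod_mul_eq hy, mul_assoc]
  exact LinearMap.congr_fun (linearMap_ext_mono
    (F := evalLinear hB hy ∘ₗ LinearMap.mulRight ℂ g)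
    (G := LinearMap.mulRight ℂ (evalLinear hB hy g) ∘ₗ evalLinear hB hy)
    (hc.comp (continuous_mul_const _)) ((continuous_mul_const _).comp hc) h1) f

/-- The continuous homomorphism `∑ a_w x^w ↦ ∑ θ(a_w) y^w` on `A{x₁, x₂; α}`, for elements `y₁`,
`y₂` with `y₁ θ(a) = θ(α(a)) y₁` and `y₂ θ(a) = θ(α⁻¹(a)) y₂`. -/
noncomputable def evalHom : EntireSeries hA hp hd α →A[ℂ] B where
  __ := AlgHom.ofLinearMap (evalLinear hB hy)
    (by rw [← mono_nil_one, evalLinear_mono]; simp) (evalLinear_mul hB hy)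
  cont := continuous_evalLinear hB hy

lemma evalHom_mono (w : Word) (a : A) :
    evalHom hB hy (mono hA hp hd α w a) = θ a * (w.map y).prod :=
  evalLinear_mono hB hy w a

end Lift

/-! ### The universal triple on the quotient. -/

section Universal

variable {A : Type*} [Ring A] [Algebra ℂ A] [TopologicalSpace A]
  {Λ : Type*} {p : Λ → Seminorm ℂ A} [Nonempty Λ] {hA : IsArensMichael A} {hp : WithSeminorms p}
  {hd : Directed (· ≤ ·) p} {α : A ≃A[ℂ] A}

lemma isClosed_laurentIdeal :
    IsClosed (laurentIdeal hA hp hd α : Set (EntireSeries hA hp hd α)) := by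
  rw [laurentIdeal, Submodule.coe_sInf]
  exact isClosed_biInter fun I hI => hI.2.1

lemma x₁_mul_x₂_sub_one_mem : x₁ hA hp hd α * x₂ hA hp hd α - 1 ∈ laurentIdeal hA hp hd α :=
  Submodule.mem_sInf.2 fun _ hI => hI.2.2.1

lemma x₂_mul_x₁_sub_one_mem : x₂ hA hp hd α * x₁ hA hp hd α - 1 ∈ laurentIdeal hA hp hd α :=
  Submodule.mem_sInf.2 fun _ hI => hI.2.2.2

theorem isArensMichael_laurentQuotient [TopologicalSpace.MetrizableSpace A] :
    IsArensMichael (LaurentQuotient hA hp hd α) := by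
  have := firstCountableTopology_entireSeries (hA := hA) (hp := hp) (hd := hd) (α := α)
  exact isArensMichael_entireSeries.quotient isClosed_laurentIdeal

variable (hA hp hd α)

/-- The class map as an algebra homomorphism. -/
noncomputable def quotientMkHom : EntireSeries hA hp hd α →ₐ[ℂ] LaurentQuotient hA hp hd α :=
  Ideal.Quotient.mkₐ ℂ (laurentIdeal hA hp hd α)

/-- The map `a ↦ [a x^w]`. -/
noncomputable def classLinear (w : Word) : A →L[ℂ] LaurentQuotient hA hp hd α where
  toLinearMap := (quotientMkHom hA hp hd α).toLinearMap ∘ₗ monoLinear hA hp hd α w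
  cont := continuous_quotientMk.comp (continuous_mono w)

variable {hA hp hd α}

lemma classOf_mul_classOf (u v : Word) (a b : A) :
    classOf hA hp hd α u a * classOf hA hp hd α v b =
      classOf hA hp hd α (u ++ v) (a * tw α u b) := by
  rw [classOf, classOf, classOf, ← map_mul, mono_mul_mono]

lemma classOf_nil_one : classOf hA hp hd α [] 1 = 1 := map_one (Ideal.Quotient.mk _)

lemma classOf_eq_of_relation {u v : Fin 2}
    (h : mono hA hp hd α [u] 1 * mono hA hp hd α [v] 1 - 1 ∈ laurentIdeal hA hp hd α) (a : A) :
    classOf hA hp hd α [u, v] a = classOf hA hp hd α [] a := by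
  have h1 : classOf hA hp hd α [u, v] 1 = 1 := by
    have h2 := (Ideal.Quotient.mk_eq_mk_iff_sub_mem _ _).2 h
    rw [mono_mul_mono, map_one, one_mul, map_one] at h2
    exact h2
  have h2 := classOf_mul_classOf (hA := hA) (hp := hp) (hd := hd) (α := α) [] [u, v] a 1
  rw [h1, mul_one] at h2
  simpa using h2.symm

variable (hA hp hd α) in
/-- The triple `a ↦ [a]`, `a ↦ [a x₁]`, `a ↦ [a x₂]`. -/
noncomputable def laurentTriple :
    CompatibleTriple (pairing₁ α) (pairing₂ α) (LaurentQuotient hA hp hd α) where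
  θ :=
    { AlgHom.ofLinearMap (classLinear hA hp hd α []).toLinearMap classOf_nil_one fun a b => by
        have := classOf_mul_classOf (hA := hA) (hp := hp) (hd := hd) (α := α) [] [] a b
        rw [tw_nil] at this
        exact this.symm with
      cont := (classLinear hA hp hd α []).cont }
  f := classLinear hA hp hd α [0]
  g := classLinear hA hp hd α [1]
  f_left a m := by
    have := classOf_mul_classOf (hA := hA) (hp := hp) (hd := hd) (α := α) [] [0] a (ofTwisted α m)
    rw [tw_nil] at this
    exact this.symm
  f_right a m := by
    have := classOf_mul_classOf (hA := hA) (hp := hp) (hd := hd) (α := α) [0] [] (ofTwisted α m) a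
    rw [tw_zero_apply] at this
    exact this.symm
  g_left a m := by
    have := classOf_mul_classOf (hA := hA) (hp := hp) (hd := hd) (α := α) [] [1] a (ofTwisted α.symm m)
    rw [tw_nil] at this
    exact this.symm
  g_right a m := by
    have := classOf_mul_classOf (hA := hA) (hp := hp) (hd := hd) (α := α) [1] [] (ofTwisted α.symm m) a
    rw [tw_one_apply] at this
    exact this.symm
  compat₁ m n := by
    have := classOf_mul_classOf (hA := hA) (hp := hp) (hd := hd) (α := α) [0] [1] (ofTwisted α m)
      (ofTwisted α.symm n)
    rw [tw_zero_apply] at this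
    exact this.trans (classOf_eq_of_relation x₁_mul_x₂_sub_one_mem _)
  compat₂ n m := by
    have := classOf_mul_classOf (hA := hA) (hp := hp) (hd := hd) (α := α) [1] [0] (ofTwisted α.symm n)
      (ofTwisted α m)
    rw [tw_one_apply] at this
    exact this.trans (classOf_eq_of_relation x₂_mul_x₁_sub_one_mem _)

lemma laurentTriple_θ (a : A) : (laurentTriple hA hp hd α).θ a = classOf hA hp hd α [] a := rfl

lemma laurentTriple_f (a : A) :
    (laurentTriple hA hp hd α).f (toTwisted α a) = classOf hA hp hd α [0] a := rfl

lemma laurentTriple_g (a : A) :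
    (laurentTriple hA hp hd α).g (toTwisted α.symm a) = classOf hA hp hd α [1] a := rfl

variable {B : Type*} [Ring B] [Algebra ℂ B] [TopologicalSpace B]

namespace CompatibleTriple

variable (t : CompatibleTriple (pairing₁ α) (pairing₂ α) B)

/-- The images `f(1)`, `g(1)` of the variables. -/
def gen : Fin 2 → B := ![t.f (toTwisted α 1), t.g (toTwisted α.symm 1)]

lemma θ_mul_gen_zero (a : A) : t.θ a * t.gen 0 = t.f (toTwisted α a) := by
  refine (t.f_left a (toTwisted α 1)).symm.trans (congrArg t.f ?_)
  exact mul_one a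

lemma θ_mul_gen_one (a : A) : t.θ a * t.gen 1 = t.g (toTwisted α.symm a) := by
  refine (t.g_left a (toTwisted α.symm 1)).symm.trans (congrArg t.g ?_)
  exact mul_one a

/-- The twisted right action becomes a commutation rule: `f(1) θ(a) = f(1 ∘ a) = f(α(a)) = θ(α(a))
f(1)`, and likewise for `g` with `α⁻¹`. -/
lemma gen_mul_θ (s : Fin 2) (a : A) : t.gen s * t.θ a = t.θ (tw α [s] a) * t.gen s := by
  fin_cases s
  · change t.gen 0 * _ = t.θ (tw α [0] a) * t.gen 0
    rw [θ_mul_gen_zero, tw_zero_apply]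
    refine (t.f_right a (toTwisted α 1)).symm.trans (congrArg t.f ?_)
    exact one_mul (α a)
  · change t.gen 1 * _ = t.θ (tw α [1] a) * t.gen 1
    rw [θ_mul_gen_one, tw_one_apply]
    refine (t.g_right a (toTwisted α.symm 1)).symm.trans (congrArg t.g ?_)
    exact one_mul (α.symm a)

lemma gen_zero_mul_gen_one : t.gen 0 * t.gen 1 = 1 := by
  refine (t.compat₁ _ _).trans ?_
  have : pairing₁ α (toTwisted α 1) (toTwisted α.symm 1) = 1 := by
    simp [pairing₁, toTwisted, ofTwisted]
  rw [this, map_one]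

lemma gen_one_mul_gen_zero : t.gen 1 * t.gen 0 = 1 := by
  refine (t.compat₂ _ _).trans ?_
  have : pairing₂ α (toTwisted α.symm 1) (toTwisted α 1) = 1 := by
    simp [pairing₂, toTwisted, ofTwisted]
  rw [this, map_one]

variable (hB : IsArensMichael B)
include hB

/-- Since `B` is Hausdorff and evaluation is continuous, its kernel is a closed two-sided ideal; it
contains both relations because the generators are mutually inverse. Minimality of the ideal does
the rest. -/
lemma laurentIdeal_le_ker :
    laurentIdeal hA hp hd α ≤
      RingHom.ker (evalHom hB t.gen_mul_θ : EntireSeries hA hp hd α →A[ℂ] B) := by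
  have := hB.t2
  have hx : ∀ u v : Fin 2, t.gen u * t.gen v = 1 →
      evalHom hB t.gen_mul_θ (mono hA hp hd α [u] 1 * mono hA hp hd α [v] 1 - 1) = 0 := by
    intro u v h
    rw [map_sub, map_mul, map_one, evalHom_mono, evalHom_mono]
    simp [h]
  refine sInf_le ⟨inferInstance, ?_, hx 0 1 t.gen_zero_mul_gen_one,
    hx 1 0 t.gen_one_mul_gen_zero⟩
  exact isClosed_singleton.preimage (evalHom hB t.gen_mul_θ).cont

/-- The homomorphism on the quotient that corresponds to a compatible triple. -/
noncomputable def lift : LaurentQuotient hA hp hd α →A[ℂ] B where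
  toAlgHom := Ideal.Quotient.liftₐ (laurentIdeal hA hp hd α)
    (evalHom hB t.gen_mul_θ : EntireSeries hA hp hd α →A[ℂ] B).toAlgHom
    fun _ hf => t.laurentIdeal_le_ker hB hf
  cont := continuous_coinduced_dom.2
    (evalHom hB t.gen_mul_θ : EntireSeries hA hp hd α →A[ℂ] B).cont

lemma lift_classOf (w : Word) (a : A) :
    (t.lift hB : LaurentQuotient hA hp hd α →A[ℂ] B) (classOf hA hp hd α w a) =
      t.θ a * (w.map t.gen).prod :=
  evalHom_mono hB t.gen_mul_θ w a

end CompatibleTriple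

/-- After pulling back along the quotient map, continuity reduces equality to monomials, and
multiplicativity reduces monomials to constants and the two variables. -/
lemma laurentQuotient_hom_ext [T2Space B] {φ ψ : LaurentQuotient hA hp hd α →A[ℂ] B}
    (hθ : ∀ a, φ (classOf hA hp hd α [] a) = ψ (classOf hA hp hd α [] a))
    (hx : ∀ s, φ (classOf hA hp hd α [s] 1) = ψ (classOf hA hp hd α [s] 1)) : φ = ψ := by
  let φ' := (φ : LaurentQuotient hA hp hd α →ₐ[ℂ] B).comp (quotientMkHom hA hp hd α)
  let ψ' := (ψ : LaurentQuotient hA hp hd α →ₐ[ℂ] B).comp (quotientMkHom hA hp hd α)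
  have h : φ'.toLinearMap = ψ'.toLinearMap := by
    refine linearMap_ext_mono (φ.cont.comp continuous_quotientMk)
      (ψ.cont.comp continuous_quotientMk) fun w a => ?_
    refine (algHom_mono φ' w a).trans (Eq.trans ?_ (algHom_mono ψ' w a).symm)
    have h1 : φ' (mono hA hp hd α [] a) = ψ' (mono hA hp hd α [] a) := hθ a
    have h2 : ∀ s, φ' (mono hA hp hd α [s] 1) = ψ' (mono hA hp hd α [s] 1) := hx
    simp only [h1, h2]
  ext x
  obtain ⟨f, rfl⟩ := Ideal.Quotient.mk_surjective x
  exact LinearMap.congr_fun h f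

theorem laurentTriple_universal (hB : IsArensMichael B)
    (t : CompatibleTriple (pairing₁ α) (pairing₂ α) B) :
    ∃! φ : LaurentQuotient hA hp hd α →A[ℂ] B,
      (∀ a, φ ((laurentTriple hA hp hd α).θ a) = t.θ a) ∧
      (∀ m, φ ((laurentTriple hA hp hd α).f m) = t.f m) ∧
      (∀ n, φ ((laurentTriple hA hp hd α).g n) = t.g n) := by
  have := hB.t2
  refine ⟨t.lift hB, ⟨fun a => ?_, fun m => ?_, fun n => ?_⟩, fun φ hφ => ?_⟩
  · exact (t.lift_classOf hB [] a).trans (mul_one _)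
  · refine (t.lift_classOf hB [0] (ofTwisted α m)).trans ?_
    rw [List.map_singleton, List.prod_singleton]
    exact t.θ_mul_gen_zero (ofTwisted α m)
  · refine (t.lift_classOf hB [1] (ofTwisted α.symm n)).trans ?_
    rw [List.map_singleton, List.prod_singleton]
    exact t.θ_mul_gen_one (ofTwisted α.symm n)
  · refine laurentQuotient_hom_ext (fun a => ?_) fun s => ?_
    · rw [t.lift_classOf, ← laurentTriple_θ, hφ.1]
      simp
    · rw [t.lift_classOf]
      fin_cases s
      · refine (hφ.2.1 (toTwisted α 1)).trans ?_
        simp [CompatibleTriple.gen]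
      · refine (hφ.2.2 (toTwisted α.symm 1)).trans ?_
        simp [CompatibleTriple.gen]

end Universal

/-- Two algebras with universal triples, with values in a common universe, are isomorphic. -/
theorem IsLaurentTensorAlgebra.exists_equiv {A M N : Type*} [Ring A] [Algebra ℂ A]
    [TopologicalSpace A]
    [AddCommGroup M] [Module ℂ M] [TopologicalSpace M] [Module A M] [Module Aᵐᵒᵖ M]
    [AddCommGroup N] [Module ℂ N] [TopologicalSpace N] [Module A N] [Module Aᵐᵒᵖ N]
    {i₁ : M → N → A} {i₂ : N → M → A}
    {L L' : Type u} [Ring L] [Algebra ℂ L] [TopologicalSpace L]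
    [Ring L'] [Algebra ℂ L'] [TopologicalSpace L']
    {t : CompatibleTriple i₁ i₂ L} {s : CompatibleTriple i₁ i₂ L'}
    (ht : IsLaurentTensorAlgebra.{u} t) (hs : IsLaurentTensorAlgebra.{u} s) :
    ∃ e : L ≃A[ℂ] L', (∀ a, e (t.θ a) = s.θ a) ∧ (∀ m, e (t.f m) = s.f m) ∧
      ∀ n, e (t.g n) = s.g n := by
  obtain ⟨φ, ⟨hφθ, hφf, hφg⟩, -⟩ := ht.2 L' hs.1 s
  obtain ⟨ψ, ⟨hψθ, hψf, hψg⟩, -⟩ := hs.2 L ht.1 t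
  -- The composite and the identity both carry the triple `t` to itself, so the uniqueness clause
  -- identifies them.
  have h1 : ψ.comp φ = ContinuousAlgHom.id ℂ L :=
    (ht.2 L ht.1 t).unique ⟨fun a => by simp [hφθ, hψθ], fun m => by simp [hφf, hψf],
      fun n => by simp [hφg, hψg]⟩ ⟨fun _ => rfl, fun _ => rfl, fun _ => rfl⟩
  have h2 : φ.comp ψ = ContinuousAlgHom.id ℂ L' :=
    (hs.2 L' hs.1 s).unique ⟨fun a => by simp [hφθ, hψθ], fun m => by simp [hφf, hψf],
      fun n => by simp [hφg, hψg]⟩ ⟨fun _ => rfl, fun _ => rfl, fun _ => rfl⟩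
  exact ⟨{ AlgEquiv.ofAlgHom (φ : L →ₐ[ℂ] L') (ψ : L' →ₐ[ℂ] L)
      (AlgHom.ext fun x => DFunLike.congr_fun h2 x)
      (AlgHom.ext fun x => DFunLike.congr_fun h1 x) with
    continuous_toFun := φ.cont
    continuous_invFun := ψ.cont }, hφθ, hφf, hφg⟩

end LaurentTensor

theorem corollary3p1 {A : Type u} [Ring A] [Algebra ℂ A] [TopologicalSpace A]
    (hA : LaurentTensor.IsArensMichael A) [TopologicalSpace.MetrizableSpace A]
    {Λ : Type w} [Nonempty Λ] {p : Λ → Seminorm ℂ A} (hp : WithSeminorms p)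
    (hd : Directed (· ≤ ·) p) (α : A ≃A[ℂ] A) :
    ∃ s : LaurentTensor.CompatibleTriple (LaurentTensor.pairing₁ α) (LaurentTensor.pairing₂ α)
        (LaurentTensor.LaurentQuotient hA hp hd α),
      (∀ a : A, s.θ a = LaurentTensor.classOf hA hp hd α [] a) ∧
      (∀ a : A, s.f (LaurentTensor.toTwisted α a) = LaurentTensor.classOf hA hp hd α [0] a) ∧
      (∀ a : A, s.g (LaurentTensor.toTwisted α.symm a) =
        LaurentTensor.classOf hA hp hd α [1] a) ∧
      LaurentTensor.IsLaurentTensorAlgebra.{v} s ∧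
      ∀ (L : Type u) [Ring L] [Algebra ℂ L] [TopologicalSpace L]
        (t : LaurentTensor.CompatibleTriple (LaurentTensor.pairing₁ α)
          (LaurentTensor.pairing₂ α) L),
        LaurentTensor.IsLaurentTensorAlgebra.{u} t →
          ∃ e : L ≃A[ℂ] LaurentTensor.LaurentQuotient hA hp hd α,
            (∀ a, e (t.θ a) = s.θ a) ∧ (∀ m, e (t.f m) = s.f m) ∧ (∀ n, e (t.g n) = s.g n) := by
  have hQ := LaurentTensor.isArensMichael_laurentQuotient (hA := hA) (hp := hp) (hd := hd) (α := α)
  exact ⟨LaurentTensor.laurentTriple hA hp hd α, LaurentTensor.laurentTriple_θ,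
    LaurentTensor.laurentTriple_f, LaurentTensor.laurentTriple_g,
    ⟨hQ, fun B _ _ _ hB t => LaurentTensor.laurentTriple_universal hB t⟩,
    -- Universality of the quotient is needed once more, now with test algebras in the universe of
    -- `A`, which contains both `L` and the quotient.
    fun L _ _ _ t ht => ht.exists_equiv
      ⟨hQ, fun B _ _ _ hB t => LaurentTensor.laurentTriple_universal hB t⟩⟩
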